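/- Let $p$ be a prime, put $\mathbf p=4$ if $p=2$ and $\mathbf p=p$ if $p$ is odd. Let $R$ be a commutative Noetherian local pro-$p$ domain of characteristic $0$ with maximal ideal $\mathfrak m$. Let $G$ be an $R$-standard group (of level $1$) of dimension $d\ge 0$: a group identified with $\mathfrak m^{(d)}$ so that $x\cdot y=\mathbf F(x,y)$ for a $d$-dimensional formal group law $\mathbf F$ over $R$. For an ideal $I\subseteq\mathfrak m$ let $G(I)\subseteq G$ be the set of elements with all coordinates in $I$. Let $A=R[[x_1,\dots,x_d]]$, regarded as a ring of functions $G\to R$, let $(\lambda_x f)(y)=f(x^{-1}y)$ and $(\rho_x f)(y)=f(yx)$ for $x,y\in G$, $f\in A$, and let $\mathbb L$ be the Lie $R$-algebra of all $R$-derivations of $A$ that commute with every $\lambda_x$, $x\in G$. For $a\in\mathbf p\mathbb L$ let $e^a=\sum_{n\ge0}a^n/n!$ in $\operatorname{End}_R(A)$ (the elements $a^n/n!$ lie in $\operatorname{End}_R(A)$ and the series converges for the filtration $p^k\operatorname{End}_R(A)$). Let $H(x_1,x_2)=\log(e^{x_1}e^{x_2})=\sum_{n\ge1}H_n(x_1,x_2)$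 be the Baker--Campbell--Hausdorff series, whose homogeneous components $H_n$ are rational Lie polynomials. For $a,b\in\mathbf p\mathbb L$ the values $H_n(a,b)$ lie in $\mathbb L$, the series $H(a,b)=\sum_n H_n(a,b)$ converges for the filtration $p^k\mathbb L$ to an element of $\mathbf p\mathbb L$, and $\Gamma(\mathbf p\mathbb L)=(\mathbf p\mathbb L,H)$ is a group. **Theorem.** $G(\mathbf pR)$ is a subgroup of $G$, and the sets $\{\rho_x\mid x\in G(\mathbf pR)\}$ and $\{e^a\mid a\in\mathbf p\mathbb L\}$ coincide and form a group of $R$-algebra automorphisms of $A$. In particular $G(\mathbf pR)\cong\Gamma(\mathbf p\mathbb L)$, by an isomorphism that sends $x\in G(\mathbf pR)$ to an element $a\in\mathbf p\mathbb L$ with $e^a=\rho_x$. -/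

import Mathlib

open scoped MvPowerSeries.WithPiTopology TensorProduct

noncomputable section

/-! ### Pro-`p` rings and evaluation of power series -/

/-- A profinite commutative ring is *pro-`p`* if all its finite discrete quotient rings have
order a power of `p`.  (Profiniteness itself is expressed by the classes `IsTopologicalRing`,
`CompactSpace`, `T2Space` and `IsLinearTopology R R`.) -/
def IsProP (p : ℕ) (R : Type*) [CommRing R] [TopologicalSpace R] : Prop :=
  ∀ I : Ideal R, IsOpen (I : Set R) → ∃ k : ℕ, Nat.card (R ⧸ I) = p ^ k

section Evaluation

variable {R : Type*} [CommRing R] [IsLocalRing R] [UniformSpace R] [IsUniformAddGroup R]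
  [IsTopologicalRing R] [IsLinearTopology R R] [CompactSpace R]

/-- In a compact linearly topologized local ring the elements of the maximal ideal are
topologically nilpotent. -/
theorem isTopologicallyNilpotent_of_mem_maximalIdeal {x : R}
    (hx : x ∈ IsLocalRing.maximalIdeal R) : IsTopologicallyNilpotent x := by
  unfold IsTopologicallyNilpotent
  rw [(IsLinearTopology.hasBasis_open_ideal (R := R)).tendsto_right_iff]
  intro I hI
  have hfin : Finite (R ⧸ I) := by
    have := AddSubgroup.quotient_finite_of_isOpen I.toAddSubgroup hI
    exact this
  obtain ⟨a, b, hab, hne⟩ : ∃ a b : ℕ, a < b ∧ x ^ a - x ^ b ∈ I := by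
    obtain ⟨a, b, hab, h⟩ :=
      Finite.exists_ne_map_eq_of_infinite (fun n : ℕ => Ideal.Quotient.mk I (x ^ n))
    rcases lt_or_gt_of_ne hab with hlt | hlt
    · exact ⟨a, b, hlt, Ideal.Quotient.eq.mp h⟩
    · exact ⟨b, a, hlt, Ideal.Quotient.eq.mp h.symm⟩
  have hmem : x ^ a ∈ I := by
    obtain ⟨c, rfl⟩ := Nat.exists_eq_add_of_lt hab
    have hxc : x ^ (c + 1) ∈ IsLocalRing.maximalIdeal R :=
      Ideal.pow_mem_of_mem _ hx _ (Nat.succ_pos c)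
    have hu : IsUnit (1 - x ^ (c + 1)) := by
      by_contra hn
      have h1 : (1 : R) ∈ IsLocalRing.maximalIdeal R := by
        have := Ideal.add_mem _ ((IsLocalRing.mem_maximalIdeal _).mpr hn) hxc
        rwa [sub_add_cancel] at this
      exact (Ideal.ne_top_iff_one _).mp (IsLocalRing.maximalIdeal.isMaximal R).ne_top h1
    have he : x ^ a - x ^ (a + c + 1) = x ^ a * (1 - x ^ (c + 1)) := by ring
    rw [he] at hne
    exact (I.mul_unit_mem_iff_mem hu).mp hne
  filter_upwards [Filter.eventually_ge_atTop a] with n hn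
  obtain ⟨k, rfl⟩ := Nat.exists_eq_add_of_le hn
  rw [pow_add]
  exact I.mul_mem_right _ hmem

/-- The maximal ideal of a compact linearly topologized local ring is closed. -/
theorem isClosed_maximalIdeal [T2Space R] :
    IsClosed ((IsLocalRing.maximalIdeal R : Ideal R) : Set R) := by
  obtain ⟨I, hI, hsub⟩ := (IsLinearTopology.hasBasis_open_ideal (R := R)).mem_iff.mp
    (isOpen_compl_singleton.mem_nhds (show (0 : R) ∈ ({1}ᶜ : Set R) by simp))
  have hle : I ≤ IsLocalRing.maximalIdeal R := IsLocalRing.le_maximalIdeal (by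
    rw [Ideal.ne_top_iff_one]
    intro h
    exact hsub h rfl)
  have hopen : IsOpen ((IsLocalRing.maximalIdeal R).toAddSubgroup : Set R) :=
    AddSubgroup.isOpen_mono (H₁ := I.toAddSubgroup) hle hI
  exact AddSubgroup.isClosed_of_isOpen _ hopen

variable {ι κ : Type*} [Finite ι]

theorem hasEval_of_mem_maximalIdeal {x : ι → R} (hx : ∀ i, x i ∈ IsLocalRing.maximalIdeal R) :
    MvPowerSeries.HasEval x where
  hpow i := isTopologicallyNilpotent_of_mem_maximalIdeal (hx i)
  tendsto_zero := by simp [Filter.cofinite_eq_bot]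

theorem hasEval_of_constantCoeff_mem {g : ι → MvPowerSeries κ R}
    (hg : ∀ i, MvPowerSeries.constantCoeff (g i) ∈ IsLocalRing.maximalIdeal R) :
    MvPowerSeries.HasEval g where
  hpow i := MvPowerSeries.LinearTopology.isTopologicallyNilpotent_of_constantCoeff
    (isTopologicallyNilpotent_of_mem_maximalIdeal (hg i))
  tendsto_zero := by simp [Filter.cofinite_eq_bot]

variable [T2Space R]

/-- The value `f(x) ∈ R` of a power series `f` at a point `x` with coordinates in the maximal
ideal. -/
def evalAt (x : ι → IsLocalRing.maximalIdeal R) : MvPowerSeries ι R →ₐ[R] R :=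
  MvPowerSeries.aeval (hasEval_of_mem_maximalIdeal (x := fun i => (x i : R)) fun i => (x i).2)

/-- The power series `f(g)` obtained by substituting for the variables of `f` power series `g i`
whose constant terms lie in the maximal ideal. -/
def substAt (g : ι → MvPowerSeries κ R)
    (hg : ∀ i, MvPowerSeries.constantCoeff (g i) ∈ IsLocalRing.maximalIdeal R) :
    MvPowerSeries ι R →ₐ[R] MvPowerSeries κ R :=
  MvPowerSeries.aeval (hasEval_of_constantCoeff_mem hg)

theorem evalAt_mem_maximalIdeal (x : ι → IsLocalRing.maximalIdeal R) {f : MvPowerSeries ι R}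
    (hf : MvPowerSeries.constantCoeff f = 0) : evalAt x f ∈ IsLocalRing.maximalIdeal R := by
  have hs := MvPowerSeries.hasSum_aeval
    (hasEval_of_mem_maximalIdeal (x := fun i => (x i : R)) fun i => (x i).2) f
  refine isClosed_maximalIdeal.mem_of_tendsto hs (Filter.Eventually.of_forall fun s => ?_)
  refine Ideal.sum_mem _ fun e _ => ?_
  rw [smul_eq_mul]
  by_cases he : e = 0
  · subst he
    rw [MvPowerSeries.coeff_zero_eq_constantCoeff_apply, hf, zero_mul]
    exact Ideal.zero_mem _
  · obtain ⟨i, hi⟩ := Finsupp.support_nonempty_iff.mpr he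
    refine Ideal.mul_mem_left _ _ ?_
    refine Ideal.mem_of_dvd _ (Finset.dvd_prod_of_mem _ hi) ?_
    exact Ideal.pow_mem_of_mem _ (x i).2 _ (Nat.pos_of_ne_zero (Finsupp.mem_support_iff.mp hi))

theorem constantCoeff_substAt (g : ι → MvPowerSeries κ R)
    (hg : ∀ i, MvPowerSeries.constantCoeff (g i) ∈ IsLocalRing.maximalIdeal R)
    (f : MvPowerSeries ι R) :
    MvPowerSeries.constantCoeff (substAt g hg f)
      = evalAt (fun i => ⟨MvPowerSeries.constantCoeff (g i), hg i⟩) f := by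
  let ε : MvPowerSeries κ R →ₐ[R] R :=
    { MvPowerSeries.constantCoeff (σ := κ) (R := R) with
      commutes' := fun r => by
        simp [MvPowerSeries.algebraMap_apply] }
  have hε : Continuous ε := MvPowerSeries.WithPiTopology.continuous_constantCoeff R
  have h := MvPowerSeries.comp_aeval (hasEval_of_constantCoeff_mem hg) hε
  exact DFunLike.congr_fun h f

theorem evalAt_substAt [Finite κ] (y : κ → IsLocalRing.maximalIdeal R)
    (g : ι → MvPowerSeries κ R)
    (hg : ∀ i, MvPowerSeries.constantCoeff (g i) ∈ IsLocalRing.maximalIdeal R)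
    (z : ι → IsLocalRing.maximalIdeal R) (hz : ∀ i, (z i : R) = evalAt y (g i))
    (f : MvPowerSeries ι R) : evalAt y (substAt g hg f) = evalAt z f := by
  have h := MvPowerSeries.comp_aeval (hasEval_of_constantCoeff_mem hg)
    (ε := evalAt y) (MvPowerSeries.continuous_aeval _)
  have h' := DFunLike.congr_fun h f
  rw [AlgHom.comp_apply] at h'
  unfold substAt
  rw [h']
  unfold evalAt
  congr 2
  funext i
  exact (hz i).symm

theorem evalAt_X (x : ι → IsLocalRing.maximalIdeal R) (i : ι) :
    evalAt x (MvPowerSeries.X i) = x i := by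
  unfold evalAt
  rw [MvPowerSeries.coe_aeval, MvPowerSeries.eval₂_X]

theorem evalAt_C (x : ι → IsLocalRing.maximalIdeal R) (r : R) :
    evalAt x (MvPowerSeries.C r) = r := by
  unfold evalAt
  rw [MvPowerSeries.coe_aeval, MvPowerSeries.eval₂_C, Algebra.algebraMap_self_apply]

end Evaluation

/-! ### Formal group laws and standard groups -/

/-- A `d`-dimensional formal group law over `R`: a `d`-tuple of power series in the `2d`
variables `X = (X_1, …, X_d)` (indexed by `Sum.inl`) and `Y = (Y_1, …, Y_d)` (indexed by
`Sum.inr`). -/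
structure FormalGroupLaw (R : Type*) [CommRing R] (d : ℕ) where
  /-- The tuple of power series `F(X, Y)`. -/
  toSeries : Fin d → MvPowerSeries (Fin d ⊕ Fin d) R
  /-- `F` has no constant term. -/
  constantCoeff_eq_zero : ∀ i, MvPowerSeries.constantCoeff (toSeries i) = 0
  /-- `F(X, 0) = X`. -/
  right_unit : ∀ i, MvPowerSeries.subst (Sum.elim MvPowerSeries.X fun _ => 0) (toSeries i)
    = (MvPowerSeries.X i : MvPowerSeries (Fin d) R)
  /-- `F(0, Y) = Y`. -/
  left_unit : ∀ i, MvPowerSeries.subst (Sum.elim (fun _ => 0) MvPowerSeries.X) (toSeries i)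
    = (MvPowerSeries.X i : MvPowerSeries (Fin d) R)
  /-- `F(F(X, Y), Z) = F(X, F(Y, Z))`. -/
  assoc : ∀ i,
    MvPowerSeries.subst
      (Sum.elim
        (fun j => MvPowerSeries.subst
          (Sum.elim (fun k => MvPowerSeries.X (Sum.inl k))
            (fun k => MvPowerSeries.X (Sum.inr (Sum.inl k)))) (toSeries j))
        (fun j => MvPowerSeries.X (Sum.inr (Sum.inr j)))) (toSeries i)
    = (MvPowerSeries.subst
      (Sum.elim
        (fun j => MvPowerSeries.X (Sum.inl j))
        (fun j => MvPowerSeries.subst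
          (Sum.elim (fun k => MvPowerSeries.X (Sum.inr (Sum.inl k)))
            (fun k => MvPowerSeries.X (Sum.inr (Sum.inr k)))) (toSeries j))) (toSeries i) :
      MvPowerSeries (Fin d ⊕ Fin d ⊕ Fin d) R)

section Standard

variable (R : Type*) [CommRing R] [IsLocalRing R] [UniformSpace R] [IsUniformAddGroup R]
  [IsTopologicalRing R] [IsLinearTopology R R] [CompactSpace R] [T2Space R]

/-- The structure of an `R`-standard group (of level `1` and dimension `d`) on a group `G`:
an identification of `G` with `𝔪^(d)`, where `𝔪` is the maximal ideal of `R`, under which the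
multiplication of `G` is given by a formal group law over `R`. -/
structure StandardGroup (d : ℕ) (G : Type*) [Group G] where
  /-- The formal group law. -/
  law : FormalGroupLaw R d
  /-- The identification of `G` with `𝔪^(d)`. -/
  coord : G ≃ (Fin d → IsLocalRing.maximalIdeal R)
  /-- `x · y = F(x, y)`. -/
  coord_mul : ∀ (x y : G) (i : Fin d),
    (coord (x * y) i : R) = evalAt (Sum.elim (coord x) (coord y)) (law.toSeries i)

namespace StandardGroup

variable {R} {d : ℕ} {G : Type*} [Group G] (S : StandardGroup R d G)

/-- For an ideal `I` of `R`, the set `G(I) = I^(d)` of elements of `G` with coordinates in `I`. -/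
def points (I : Ideal R) : Set G := {x | ∀ i, (S.coord x i : R) ∈ I}

theorem mem_left (x : G) (j : Fin d ⊕ Fin d) :
    MvPowerSeries.constantCoeff
      (Sum.elim (fun k => MvPowerSeries.C (S.coord x k : R)) MvPowerSeries.X j :
        MvPowerSeries (Fin d) R) ∈ IsLocalRing.maximalIdeal R := by
  rcases j with j | j <;> simp

theorem mem_right (x : G) (j : Fin d ⊕ Fin d) :
    MvPowerSeries.constantCoeff
      (Sum.elim MvPowerSeries.X (fun k => MvPowerSeries.C (S.coord x k : R)) j :
        MvPowerSeries (Fin d) R) ∈ IsLocalRing.maximalIdeal R := by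
  rcases j with j | j <;> simp

/-- The power series `F(x, X)`, the coordinates of the left multiplication `y ↦ x y`. -/
def leftMul (x : G) (i : Fin d) : MvPowerSeries (Fin d) R :=
  substAt _ (S.mem_left x) (S.law.toSeries i)

/-- The power series `F(X, x)`, the coordinates of the right multiplication `y ↦ y x`. -/
def rightMul (x : G) (i : Fin d) : MvPowerSeries (Fin d) R :=
  substAt _ (S.mem_right x) (S.law.toSeries i)

theorem leftMul_mem (x : G) (i : Fin d) :
    MvPowerSeries.constantCoeff (S.leftMul x i) ∈ IsLocalRing.maximalIdeal R := by
  rw [leftMul, constantCoeff_substAt]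
  exact evalAt_mem_maximalIdeal _ (S.law.constantCoeff_eq_zero i)

theorem rightMul_mem (x : G) (i : Fin d) :
    MvPowerSeries.constantCoeff (S.rightMul x i) ∈ IsLocalRing.maximalIdeal R := by
  rw [rightMul, constantCoeff_substAt]
  exact evalAt_mem_maximalIdeal _ (S.law.constantCoeff_eq_zero i)

/-- The action of `G` on `A = R[[X_1, …, X_d]]` by left translation,
`(λ_x f)(y) = f(x⁻¹ y)`. -/
def leftTranslation (x : G) : MvPowerSeries (Fin d) R →ₐ[R] MvPowerSeries (Fin d) R :=
  substAt (S.leftMul x⁻¹) (S.leftMul_mem x⁻¹)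

/-- The action of `G` on `A = R[[X_1, …, X_d]]` by right translation,
`(ρ_x f)(y) = f(y x)`. -/
def rightTranslation (x : G) : MvPowerSeries (Fin d) R →ₐ[R] MvPowerSeries (Fin d) R :=
  substAt (S.rightMul x) (S.rightMul_mem x)

theorem evalAt_leftTranslation (x y : G) (f : MvPowerSeries (Fin d) R) :
    evalAt (S.coord y) (S.leftTranslation x f) = evalAt (S.coord (x⁻¹ * y)) f := by
  refine evalAt_substAt _ _ _ _ (fun i => ?_) f
  rw [S.coord_mul, leftMul]
  refine (evalAt_substAt _ _ _ _ (fun j => ?_) _).symm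
  rcases j with j | j
  · simp [evalAt_C]
  · simp [evalAt_X]

theorem evalAt_rightTranslation (x y : G) (f : MvPowerSeries (Fin d) R) :
    evalAt (S.coord y) (S.rightTranslation x f) = evalAt (S.coord (y * x)) f := by
  refine evalAt_substAt _ _ _ _ (fun i => ?_) f
  rw [S.coord_mul, rightMul]
  refine (evalAt_substAt _ _ _ _ (fun j => ?_) _).symm
  rcases j with j | j
  · simp [evalAt_X]
  · simp [evalAt_C]

/-- The Lie algebra `𝕃 = Der_l(A)` of left invariant `R`-derivations of
`A = R[[X_1, …, X_d]]`: the derivations commuting with all left translations. -/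
def lieAlgebra : LieSubalgebra R
    (Derivation R (MvPowerSeries (Fin d) R) (MvPowerSeries (Fin d) R)) where
  carrier := {w | ∀ (x : G) (f : MvPowerSeries (Fin d) R),
    w (S.leftTranslation x f) = S.leftTranslation x (w f)}
  add_mem' := by
    intro v w hv hw x f
    simp [hv x f, hw x f]
  zero_mem' := by
    intro x f
    simp
  smul_mem' := by
    intro r w hw x f
    simp [hw x f]
  lie_mem' := by
    intro v w hv hw x f
    simp [Derivation.commutator_apply, hv x, hw x]

end StandardGroup

end Standard

/-! ### The `p`-adic topology, the exponential and the Baker–Campbell–Hausdorff formula -/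

/-- The number denoted by a bold `p`: it is `4` if `p = 2`, and `p` if `p` is odd. -/
def boldP (p : ℕ) : ℕ := if p = 2 then 4 else p

/-- `u n` tends to `c` in the topology on `M` induced by the filtration `p ^ k M`. -/
def PadicTendsto (p : ℕ) {M : Type*} [AddCommGroup M] (u : ℕ → M) (c : M) : Prop :=
  ∀ k : ℕ, ∃ N : ℕ, ∀ n, N ≤ n → ∃ w : M, u n - c = p ^ k • w

/-- `t = e^a` in the associative ring `D`: there are elements `u n = a ^ n / n!` of `D` such that
the series `∑ u n` converges `p`-adically to `t`.  (In a ring without torsion the elements `u n`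
are uniquely determined.) -/
def IsPadicExp (p : ℕ) {D : Type*} [Ring D] (a t : D) : Prop :=
  ∃ u : ℕ → D, (∀ n, n.factorial • u n = a ^ n) ∧
    PadicTendsto p (fun N => ∑ n ∈ Finset.range N, u n) t

/-- The power series `e^{T x} = ∑ x^n T^n / n!` in the central variable `T`, where `x` is an
element of a `ℚ`-algebra. -/
def expSeries {B : Type*} [Ring B] [Algebra ℚ B] (x : B) : PowerSeries B :=
  PowerSeries.mk fun n => ((n.factorial : ℚ)⁻¹) • x ^ n

/-- The homogeneous component `H_n(x_1, x_2)` of degree `n` of the Baker–Campbell–Hausdorff series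
`H(x_1, x_2) = log (e^{x_1} e^{x_2}) = ∑_{k ≥ 1} (-1)^{k+1} (e^{x_1} e^{x_2} - 1)^k / k`, as an
element of the free associative `ℚ`-algebra on `x_1, x_2`.  It is obtained as the coefficient
of `T^n` in `H(T x_1, T x_2)`, to which only the terms with `k ≤ n` contribute. -/
def bchComponent (n : ℕ) : FreeAlgebra ℚ (Fin 2) :=
  ∑ k ∈ Finset.Icc 1 n, ((-1 : ℚ) ^ (k + 1) / k) •
    PowerSeries.coeff n
      ((expSeries (FreeAlgebra.ι ℚ (0 : Fin 2)) * expSeries (FreeAlgebra.ι ℚ (1 : Fin 2)) - 1) ^ k)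

section BCH

attribute [local instance] LieRing.ofAssociativeRing

/-- The canonical map from the free Lie `ℚ`-algebra on `x_1, x_2` to the free associative
`ℚ`-algebra on `x_1, x_2`. -/
def freeLieToAssoc : FreeLieAlgebra ℚ (Fin 2) →ₗ⁅ℚ⁆ FreeAlgebra ℚ (Fin 2) :=
  FreeLieAlgebra.lift ℚ fun i => FreeAlgebra.ι ℚ i

end BCH

/-- The value in `ℚ ⊗ M` of a rational Lie polynomial `h` in two variables at two elements
`a, b` of a Lie ring `M`. -/
def evalLiePolynomial {M : Type*} [LieRing M] (a b : M) (h : FreeLieAlgebra ℚ (Fin 2)) :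
    ℚ ⊗[ℤ] M :=
  FreeLieAlgebra.lift ℚ ![(1 : ℚ) ⊗ₜ[ℤ] a, (1 : ℚ) ⊗ₜ[ℤ] b] h

/-- `H_n(a, b) = c` in the (torsion-free) Lie ring `M`: the homogeneous component
`H_n(x_1, x_2)` is a Lie polynomial, whose value at `(a, b)`, a priori an element of `ℚ ⊗ M`,
is the element `c` of `M`. -/
def IsBCHTerm {M : Type*} [LieRing M] (n : ℕ) (a b c : M) : Prop :=
  ∃ h : FreeLieAlgebra ℚ (Fin 2), freeLieToAssoc h = bchComponent n ∧
    evalLiePolynomial a b h = (1 : ℚ) ⊗ₜ[ℤ] c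

/-- `H(a, b) = c` in the Lie ring `M`: the terms `H_n(a, b)` are elements of `M` and
the series `∑_{n ≥ 1} H_n(a, b)` converges to `c` in the topology induced by the filtration
`p ^ k M`. -/
def IsBCH (p : ℕ) {M : Type*} [LieRing M] (a b c : M) : Prop :=
  ∃ h : ℕ → M, (∀ n, IsBCHTerm n a b (h n)) ∧
    PadicTendsto p (fun N => ∑ n ∈ Finset.Icc 1 N, h n) c

namespace StandardGroup

variable {R : Type*} [CommRing R] [IsLocalRing R] [UniformSpace R] [IsUniformAddGroup R]
  [IsTopologicalRing R] [IsLinearTopology R R] [CompactSpace R] [T2Space R]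
  {d : ℕ} {G : Type*} [Group G] (S : StandardGroup R d G)

/-- The multiple `c 𝕃` of the Lie algebra `𝕃` by an integer `c`. -/
def multipleLie (c : ℕ) : Submodule R S.lieAlgebra :=
  LinearMap.range (LinearMap.lsmul R S.lieAlgebra (c : R))

/-- An element of `𝕃` regarded as an `R`-linear endomorphism of `A = R[[X_1, …, X_d]]`. -/
def toEnd (a : S.lieAlgebra) : Module.End R (MvPowerSeries (Fin d) R) :=
  ((a : Derivation R (MvPowerSeries (Fin d) R) (MvPowerSeries (Fin d) R)) :
    MvPowerSeries (Fin d) R →ₗ[R] MvPowerSeries (Fin d) R)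

end StandardGroup

end

/-! Write `D` for the endomorphism ring of the `R`-module `A`. Compactness and Krull's intersection
theorem make `R` torsion-free, separated and complete for the filtration by the `p ^ k R`
(`isPadicComplete_of_isProP`). These properties pass to `A`, a product of copies of `R`, and then to
`D`.

In such a ring, Legendre's bound on the valuation of `n!` makes the exponential a bijection from
`𝐩D` to `1 + 𝐩D` (`exists_isPadicExp`, `IsPadicExp.sub_one_mem`, `exists_isPadicExp_eq`,
`IsPadicExp.injective`), and the Baker–Campbell–Hausdorff formula holds (`exists_bch`). It remains
to see which exponents give right translations.

If `a ∈ 𝐩𝕃`, then `e^a` is an algebra endomorphism of `A` that commutes with all left translations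
and is `1` modulo `𝐩`. Followed by evaluation at the identity of `G`, it becomes evaluation at some
point `x ∈ G(𝐩R)`; left invariance carries this to every point of `G`, so `e^a = ρ_x`
(`exists_rightTranslation_eq`).

Conversely, `F(X, x) ≡ X` modulo `𝐩` gives `ρ_x ∈ 1 + 𝐩D`, so `ρ_x = e^a` with `a ∈ 𝐩D`. Since `ρ_x
^ (p ^ k) = 1 + p ^ k a` modulo `p ^ (2k)`, the operator `a` is a `p`-adic derivative of
automorphisms commuting with left translations; hence it is a left invariant derivation
(`IsPadicExp.leibniz_of_map_mul`, `IsPadicExp.commute_of_pow_commute`).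

The group law on `𝐩𝕃` is transported from `G(𝐩R)`, and `exists_bch` identifies it with `H`. The
values `H_n(a, b)` lie in `𝕃` because `H_n` is a Lie polynomial (`coeff_mem_of_exp_eq`) and `𝕃` is
saturated in `D` (`exists_toEndHom_eq_of_smul_eq`). -/

noncomputable section

namespace PowerSeries

open Finset

/-! ### Composition of rational power series with power series over a noncommutative algebra -/

theorem coeff_pow_eq_zero_of_lt {B : Type*} [Semiring B] {U : B⟦X⟧}
    (hU : constantCoeff U = 0) {n k : ℕ} (h : n < k) : coeff n (U ^ k) = 0 :=
  coeff_of_lt_order _ (lt_of_lt_of_le (by exact_mod_cast h)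
    (le_order_pow_of_constantCoeff_eq_zero k hU))

/-- A sum over the triangle `a + b ≤ n` may be taken over the square `a, b ≤ n` if the summand
vanishes off the triangle. This serves formal composition, where orders force the vanishing, and
also `p`-adic Cauchy products, where it holds modulo `p ^ k`. -/
theorem sum_range_antidiagonal_eq_sum_product {M : Type*} [AddCommMonoid M] (n : ℕ)
    (h : ℕ → ℕ → M) (hh : ∀ a b, n < a + b → h a b = 0) :
    ∑ c ∈ range (n + 1), ∑ x ∈ antidiagonal c, h x.1 x.2
      = ∑ a ∈ range (n + 1), ∑ b ∈ range (n + 1), h a b := by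
  rw [← sum_product', sum_sigma']
  refine sum_of_injOn (fun x => x.2) ?_ ?_ ?_ ?_
  · rintro ⟨c, a, b⟩ hx ⟨c', a', b'⟩ hx' he
    simp only [coe_sigma, Set.mem_sigma_iff, mem_coe, mem_range, HasAntidiagonal.mem_antidiagonal] at hx hx'
    simp only at he
    obtain ⟨-, rfl⟩ := hx
    obtain ⟨-, rfl⟩ := hx'
    obtain ⟨rfl, rfl⟩ := Prod.mk.inj he
    rfl
  · rintro ⟨c, a, b⟩ hx
    simp only [coe_sigma, Set.mem_sigma_iff, mem_coe, mem_range, HasAntidiagonal.mem_antidiagonal] at hx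
    simp only [coe_product, Set.mem_prod, mem_coe, mem_range]
    omega
  · rintro ⟨a, b⟩ - hx
    refine hh a b ?_
    by_contra hc
    refine hx ⟨⟨a + b, a, b⟩, ?_, rfl⟩
    simp only [coe_sigma, Set.mem_sigma_iff, mem_coe, mem_range, HasAntidiagonal.mem_antidiagonal, and_true]
    omega
  · simp

section Composition

variable {B : Type*} [Ring B] [Algebra ℚ B]

/-- The composition `f(U)` of a rational power series with a series `U` over a `ℚ`-algebra
(meaningful if `U` has no constant term). -/
def seriesComp (f : ℚ⟦X⟧) (U : B⟦X⟧) : B⟦X⟧ :=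
  mk fun n => ∑ k ∈ range (n + 1), coeff k f • coeff n (U ^ k)

theorem coeff_seriesComp {U : B⟦X⟧} (hU : constantCoeff U = 0) (f : ℚ⟦X⟧) {n N : ℕ} (h : n ≤ N) :
    coeff n (seriesComp f U) = ∑ k ∈ range (N + 1), coeff k f • coeff n (U ^ k) := by
  rw [seriesComp, coeff_mk]
  refine sum_subset (range_mono (by omega)) fun k _ hk => ?_
  rw [coeff_pow_eq_zero_of_lt hU (by simpa using hk), smul_zero]

theorem seriesComp_mul {U : B⟦X⟧} (hU : constantCoeff U = 0) (f g : ℚ⟦X⟧) :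
    seriesComp (f * g) U = seriesComp f U * seriesComp g U := by
  ext n
  have h1 : ∀ x ∈ antidiagonal n, coeff x.1 (seriesComp f U) * coeff x.2 (seriesComp g U)
      = ∑ a ∈ range (n + 1), ∑ b ∈ range (n + 1),
        (coeff a f * coeff b g) • (coeff x.1 (U ^ a) * coeff x.2 (U ^ b)) := by
    intro x hx
    rw [HasAntidiagonal.mem_antidiagonal] at hx
    rw [coeff_seriesComp hU f (show x.1 ≤ n by omega),
      coeff_seriesComp hU g (show x.2 ≤ n by omega), sum_mul_sum]
    simp only [smul_mul_smul_comm]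
  rw [coeff_mul, sum_congr rfl h1, sum_comm]
  have h2 : ∀ a b : ℕ, ∑ x ∈ antidiagonal n,
      (coeff a f * coeff b g) • (coeff x.1 (U ^ a) * coeff x.2 (U ^ b))
        = (coeff a f * coeff b g) • coeff n (U ^ (a + b)) := by
    intro a b
    rw [pow_add, coeff_mul, smul_sum]
  have h3 : ∀ a ∈ range (n + 1), ∑ x ∈ antidiagonal n, ∑ b ∈ range (n + 1),
      (coeff a f * coeff b g) • (coeff x.1 (U ^ a) * coeff x.2 (U ^ b))
        = ∑ b ∈ range (n + 1), (coeff a f * coeff b g) • coeff n (U ^ (a + b)) := by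
    intro a _
    rw [sum_comm]
    exact sum_congr rfl fun b _ => h2 a b
  rw [sum_congr rfl h3, ← sum_range_antidiagonal_eq_sum_product n
    (fun a b => (coeff a f * coeff b g) • coeff n (U ^ (a + b))), coeff_seriesComp hU _ le_rfl]
  · refine sum_congr rfl fun c _ => ?_
    rw [coeff_mul, sum_smul]
    refine sum_congr rfl fun x hx => ?_
    rw [HasAntidiagonal.mem_antidiagonal.mp hx]
  · intro a b hab
    rw [coeff_pow_eq_zero_of_lt hU hab, smul_zero]

theorem seriesComp_one {U : B⟦X⟧} : seriesComp 1 U = 1 := by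
  ext n
  rw [seriesComp, coeff_mk, sum_eq_single 0]
  · simp
  · intro k _ hk
    simp [coeff_one, hk]
  · simp

theorem seriesComp_pow {U : B⟦X⟧} (hU : constantCoeff U = 0) (f : ℚ⟦X⟧) (n : ℕ) :
    seriesComp (f ^ n) U = seriesComp f U ^ n := by
  induction n with
  | zero => simp [seriesComp_one]
  | succ n ih => rw [pow_succ, pow_succ, seriesComp_mul hU, ih]

theorem constantCoeff_seriesComp {U : B⟦X⟧} {f : ℚ⟦X⟧} (hf : constantCoeff f = 0) :
    constantCoeff (seriesComp f U) = 0 := by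
  rw [← coeff_zero_eq_constantCoeff_apply, seriesComp, coeff_mk]
  simp [hf]

/-- The series `E = exp(log(1 + X))` solves `(1 + X) E' = E` with `E(0) = 1`, and so does `1 + X`;
the equation determines the coefficients recursively. -/
theorem exp_subst_log : (exp ℚ).subst (log ℚ) = 1 + X := by
  set E := (exp ℚ).subst (log ℚ) with hE
  have hd : (1 + X) * d⁄dX ℚ E = E := by
    have h1 : (1 + X) * d⁄dX ℚ (log ℚ) = 1 := by
      rw [deriv_log, add_mul, one_mul]
      ext n
      cases n with
      | zero => simp
      | succ n => simp [coeff_succ_X_mul, coeff_one, pow_succ]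
    rw [hE, derivative_subst HasSubst.log, derivative_exp, mul_left_comm, h1, mul_one]
  have h0 : coeff 0 E = 1 := by
    rw [hE, coeff_subst' HasSubst.log, finsum_eq_single _ 0]
    · simp
    · intro n hn
      simp [hn]
  -- In terms of coefficients this is `(n + 1) e_{n+1} = (1 - n) e_n`: the factor `1 - n` kills
  -- `e_2`, and then everything above it.
  have hrec : ∀ n, coeff (n + 1) E * (n + 1) + coeff n E * n = coeff n E := by
    intro n
    have h := congrArg (coeff n) hd
    rw [add_mul, one_mul, map_add, coeff_derivative] at h
    cases n with
    | zero => simpa using h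
    | succ n =>
      rw [coeff_succ_X_mul, coeff_derivative] at h
      push_cast at h ⊢
      exact h
  have h2 : ∀ n, coeff (n + 2) E = 0 := by
    intro n
    induction n with
    | zero =>
      have := hrec 1
      push_cast at this
      linarith
    | succ n ih =>
      have h := hrec (n + 2)
      rw [ih] at h
      simp only [zero_mul, add_zero, mul_eq_zero] at h
      rcases h with h | h
      · exact h
      · exfalso
        push_cast at h
        have : (0 : ℚ) ≤ n := n.cast_nonneg
        linarith
  ext n
  rcases n with _ | _ | n
  · simpa using h0
  · have h := hrec 0
    rw [h0] at h
    simpa [coeff_one] using h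
  · rw [h2 n]
    simp [coeff_one, coeff_X]

theorem sum_coeff_log_pow (m : ℕ) {N : ℕ} (h : m ≤ N) :
    ∑ n ∈ range (N + 1), (n.factorial : ℚ)⁻¹ * coeff m (log ℚ ^ n)
      = coeff m (1 + X : ℚ⟦X⟧) := by
  rw [← exp_subst_log, coeff_subst' HasSubst.log,
    finsum_eq_sum_of_support_subset (s := range (N + 1))]
  · refine sum_congr rfl fun n _ => ?_
    simp [coeff_exp]
  · intro n hn
    simp only [coe_range, Set.mem_Iio]
    by_contra hlt
    refine hn ?_
    simp only
    rw [coeff_pow_eq_zero_of_lt constantCoeff_log (by omega), smul_zero]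

/-- `exp (log (1 + U)) = 1 + U`. -/
theorem sum_coeff_seriesComp_log_pow {U : B⟦X⟧} (hU : constantCoeff U = 0) (m : ℕ) :
    ∑ n ∈ range (m + 1), (n.factorial : ℚ)⁻¹ • coeff m (seriesComp (log ℚ) U ^ n)
      = coeff m (1 + U) := by
  have h1 : ∀ n ∈ range (m + 1),
      (n.factorial : ℚ)⁻¹ • coeff m (seriesComp (log ℚ) U ^ n)
        = ∑ j ∈ range (m + 1), ((n.factorial : ℚ)⁻¹ * coeff j (log ℚ ^ n)) • coeff m (U ^ j) := by
    intro n _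
    rw [← seriesComp_pow hU, coeff_seriesComp hU _ le_rfl, smul_sum]
    simp only [smul_smul]
  rw [sum_congr rfl h1, sum_comm]
  have h2 : ∀ j ∈ range (m + 1), ∑ n ∈ range (m + 1),
      ((n.factorial : ℚ)⁻¹ * coeff j (log ℚ ^ n)) • coeff m (U ^ j)
        = coeff j (1 + X : ℚ⟦X⟧) • coeff m (U ^ j) := by
    intro j hj
    rw [← sum_smul, sum_coeff_log_pow j (by simpa [Nat.lt_succ_iff] using hj)]
  rw [sum_congr rfl h2, map_add]
  cases m with
  | zero => simp [hU]
  | succ m =>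
    rw [← add_sum_erase _ _ (show 0 ∈ range (m + 1 + 1) by simp), ← add_sum_erase _ _
      (show 1 ∈ (range (m + 1 + 1)).erase 0 by simp), sum_eq_zero]
    · simp [coeff_one, coeff_X]
    · intro j hj
      simp only [mem_erase] at hj
      simp [coeff_one, coeff_X, hj.1, hj.2.1]

end Composition

end PowerSeries

namespace PowerSeries

open Finset

/-! ### The logarithmic derivative of an exponential -/

section Euler

variable {B : Type*} [Ring B]

/-- The Euler operator `T d/dT` on power series. -/
def euler : B⟦X⟧ →+ B⟦X⟧ where
  toFun f := mk fun n => n • coeff n f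
  map_zero' := by ext; simp
  map_add' f g := by ext; simp

theorem coeff_euler (f : B⟦X⟧) (n : ℕ) : coeff n (euler f) = n • coeff n f :=
  coeff_mk n fun n => n • coeff n f

theorem euler_mul (f g : B⟦X⟧) : euler (f * g) = euler f * g + f * euler g := by
  ext n
  rw [coeff_euler, map_add, coeff_mul, coeff_mul, coeff_mul, ← sum_add_distrib, smul_sum]
  refine sum_congr rfl fun x hx => ?_
  rw [HasAntidiagonal.mem_antidiagonal] at hx
  rw [coeff_euler, coeff_euler, ← hx, add_smul, smul_mul_assoc, mul_smul_comm]

/-- The iterated commutators `[… [[w, z], z] …, z]`. -/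
def iteratedBracket {C : Type*} [Ring C] (w z : C) : ℕ → C
  | 0 => w
  | k + 1 => iteratedBracket w z k * z - z * iteratedBracket w z k

theorem iteratedBracket_mul {C : Type*} [Ring C] (w z : C) (k : ℕ) :
    iteratedBracket w z k * z
      = iteratedBracket w z (k + 1) + z * iteratedBracket w z k := by
  rw [iteratedBracket, sub_add_cancel]

/-- Right multiplication by `z` is the sum of left multiplication by `z` and the commutator `[·,
z]`. These two operators commute, so its `n`-th power expands by the binomial theorem. -/
theorem mul_pow_eq_sum_iteratedBracket {C : Type*} [Ring C] (w z : C) (n : ℕ) :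
    w * z ^ n = ∑ k ∈ range (n + 1), n.choose k • (z ^ (n - k) * iteratedBracket w z k) := by
  induction n with
  | zero => simp [iteratedBracket]
  | succ n ih =>
    rw [pow_succ, ← mul_assoc, ih, sum_mul, sum_range_succ' _ (n + 1)]
    have h1 : ∀ k ∈ range (n + 1), n.choose k • (z ^ (n - k) * iteratedBracket w z k) * z
        = n.choose k • (z ^ (n - k) * iteratedBracket w z (k + 1))
          + n.choose k • (z ^ (n + 1 - k) * iteratedBracket w z k) := by
      intro k hk
      rw [mem_range] at hk
      rw [smul_mul_assoc, mul_assoc, iteratedBracket_mul, mul_add, smul_add, ← mul_assoc,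
        ← pow_succ, Nat.succ_sub (by omega)]
    have h2 : ∀ k ∈ range (n + 1),
        (n + 1).choose (k + 1) • (z ^ (n + 1 - (k + 1)) * iteratedBracket w z (k + 1))
        = n.choose k • (z ^ (n - k) * iteratedBracket w z (k + 1))
          + n.choose (k + 1) • (z ^ (n + 1 - (k + 1)) * iteratedBracket w z (k + 1)) := by
      intro k _
      rw [Nat.choose_succ_succ, add_smul, Nat.succ_sub_succ]
    rw [sum_congr rfl h1, sum_congr rfl h2, sum_add_distrib, sum_add_distrib, add_assoc]
    congr 1
    have h3 := sum_range_succ' (fun k => n.choose k • (z ^ (n + 1 - k) * iteratedBracket w z k))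
      (n + 1)
    rw [sum_range_succ, Nat.choose_succ_self, zero_smul, add_zero] at h3
    rw [h3]
    simp

/-- By the Leibniz rule the left side is `∑ Z^i (euler Z) Z^j` over `i + j = n`. Moving the powers
of `Z` to the left produces binomial coefficients `j.choose k`, whose sum over `j ≤ n` is `(n +
1).choose (k + 1)`; the induction carries this out with Pascal's rule. -/
theorem euler_pow (Z : B⟦X⟧) (n : ℕ) :
    euler (Z ^ (n + 1)) = ∑ k ∈ range (n + 1),
      (n + 1).choose (k + 1) • (Z ^ (n - k) * iteratedBracket (euler Z) Z k) := by
  induction n with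
  | zero => simp [iteratedBracket]
  | succ n ih =>
    set w := iteratedBracket (euler Z) Z with hw
    have h1 : ∀ k ∈ range (n + 1), (n + 1).choose (k + 1) • (Z ^ (n - k) * w k) * Z
        = (n + 1).choose (k + 1) • (Z ^ (n - k) * w (k + 1))
          + (n + 1).choose (k + 1) • (Z ^ (n + 1 - k) * w k) := by
      intro k hk
      rw [mem_range] at hk
      rw [smul_mul_assoc, mul_assoc, hw, iteratedBracket_mul, mul_add, smul_add, ← mul_assoc,
        ← pow_succ, Nat.succ_sub (by omega)]
    have h2 : ∀ k ∈ range (n + 1 + 1), (n + 1 + 1).choose (k + 1) • (Z ^ (n + 1 - k) * w k)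
        = (n + 1).choose k • (Z ^ (n + 1 - k) * w k)
          + (n + 1).choose (k + 1) • (Z ^ (n + 1 - k) * w k) := by
      intro k _
      rw [Nat.choose_succ_succ, add_smul]
    rw [pow_succ, euler_mul, ih, sum_mul, sum_congr rfl h1, sum_congr rfl h2, sum_add_distrib,
      sum_add_distrib, sum_range_succ' (fun k => (n + 1).choose k • (Z ^ (n + 1 - k) * w k)),
      sum_range_succ (fun k => (n + 1).choose (k + 1) • (Z ^ (n + 1 - k) * w k)) (n + 1),
      Nat.choose_succ_self, zero_smul, add_zero]
    simp only [Nat.succ_sub_succ]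
    rw [add_right_comm]
    simp [hw, iteratedBracket]

/-- Both `euler Z` and `Z` have order at least `1`, and each bracket with `Z` raises the order by at
least `1`. Hence only finitely many iterated brackets contribute to a given degree. -/
theorem coeff_iteratedBracket_euler_of_lt {Z : B⟦X⟧} (hZ : constantCoeff Z = 0) (k : ℕ) :
    ∀ i ≤ k, coeff i (iteratedBracket (euler Z) Z k) = 0 := by
  have h0 : coeff 0 Z = 0 := by simpa using hZ
  induction k with
  | zero =>
    intro i hi
    obtain rfl : i = 0 := by omega
    simp [iteratedBracket, coeff_euler, -coeff_zero_eq_constantCoeff]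
  | succ k ih =>
    intro i hi
    rw [iteratedBracket, map_sub, coeff_mul, coeff_mul, sum_eq_zero, sum_eq_zero, sub_zero]
    · intro x hx
      rw [HasAntidiagonal.mem_antidiagonal] at hx
      rcases Nat.eq_zero_or_pos x.1 with h | h
      · rw [h, h0, zero_mul]
      · rw [ih _ (by omega), mul_zero]
    · intro x hx
      rw [HasAntidiagonal.mem_antidiagonal] at hx
      rcases Nat.eq_zero_or_pos x.2 with h | h
      · rw [h, h0, mul_zero]
      · rw [ih _ (by omega), zero_mul]

theorem coeff_mul_eq_zero_of_lt {f g : B⟦X⟧} {a b m : ℕ} (hf : ∀ i < a, coeff i f = 0)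
    (hg : ∀ i < b, coeff i g = 0) (h : m < a + b) : coeff m (f * g) = 0 := by
  rw [coeff_mul]
  refine sum_eq_zero fun x hx => ?_
  rw [HasAntidiagonal.mem_antidiagonal] at hx
  rcases lt_or_ge x.1 a with h1 | h1
  · rw [hf _ h1, zero_mul]
  · rw [hg _ (by omega), mul_zero]

theorem mul_left_cancel_of_constantCoeff_eq_one {f g h : B⟦X⟧} (hf : constantCoeff f = 1)
    (hgh : f * g = f * h) : g = h := by
  ext n
  induction n using Nat.strong_induction_on with
  | _ n ih =>
    have e := congrArg (coeff n) hgh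
    have hmem : ((0, n) : ℕ × ℕ) ∈ antidiagonal n := by simp
    rw [coeff_mul, coeff_mul, ← add_sum_erase _ _ hmem, ← add_sum_erase _ _ hmem] at e
    simp only [coeff_zero_eq_constantCoeff, hf, one_mul] at e
    rw [sum_congr rfl (g := fun x => coeff x.1 f * coeff x.2 h)] at e
    · exact add_right_cancel e
    · rintro ⟨i, j⟩ hx
      simp only [mem_erase, ne_eq, HasAntidiagonal.mem_antidiagonal, Prod.mk.injEq] at hx
      rw [ih j (by omega)]

variable [Algebra ℚ B]

/-- The logarithmic derivative of the exponential: if `G = e^Z`, then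
`T G' = G ∑ (-1)^k (ad Z)^k (T Z') / (k + 1)!`. -/
theorem euler_exp {Z G : B⟦X⟧} (hZ : constantCoeff Z = 0)
    (hG : ∀ m, ∑ n ∈ range (m + 1), (n.factorial : ℚ)⁻¹ • coeff m (Z ^ n) = coeff m G) :
    euler G = G * mk fun m => ∑ k ∈ range (m + 1),
      ((k + 1).factorial : ℚ)⁻¹ • coeff m (iteratedBracket (euler Z) Z k) := by
  set w := iteratedBracket (euler Z) Z with hw
  have hw0 : ∀ k i, i ≤ k → coeff i (w k) = 0 :=
    fun k i hi => coeff_iteratedBracket_euler_of_lt hZ k i hi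
  ext m
  -- Both sides equal the sum of `Z^a w_k / (a! (k + 1)!)` over all `a, k`, taken in degree `m`. The
  -- left side groups the terms by `a + k`, since `euler_pow` has `(c + 1).choose (k + 1) / (c + 1)!
  -- = 1 / ((c - k)! (k + 1)!)`.
  set h : ℕ → ℕ → B := fun a k =>
    ((a.factorial : ℚ)⁻¹ * ((k + 1).factorial : ℚ)⁻¹) • coeff m (Z ^ a * w k) with hh
  have hvan : ∀ a k, m ≤ a + k → h a k = 0 := by
    intro a k hak
    simp only [hh]
    rw [coeff_mul_eq_zero_of_lt (a := a) (b := k + 1)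
      (fun i hi => coeff_pow_eq_zero_of_lt hZ hi) (fun i hi => hw0 k i (by omega)) (by omega),
      smul_zero]
  have hleft : coeff m (euler G)
      = ∑ c ∈ range (m + 1), ∑ x ∈ antidiagonal c, h x.1 x.2 := by
    rw [sum_range_succ, sum_eq_zero (s := antidiagonal m), add_zero]
    · rw [coeff_euler, ← hG, smul_sum, sum_range_succ']
      have hz : m • ((Nat.factorial 0 : ℚ)⁻¹ • coeff m (Z ^ 0)) = 0 := by
        rcases m with _ | m <;> simp [coeff_one]
      rw [hz, add_zero]
      refine sum_congr rfl fun c _ => ?_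
      rw [smul_comm, ← coeff_euler, euler_pow, map_sum, smul_sum,
        ← Nat.sum_antidiagonal_swap]
      simp only [Prod.fst_swap, Prod.snd_swap]
      rw [Nat.sum_antidiagonal_eq_sum_range_succ (fun k a => h a k)]
      refine sum_congr rfl fun k hk => ?_
      have hk' : k + 1 ≤ c + 1 := by simpa [Nat.lt_succ_iff] using hk
      simp only [hh]
      rw [map_nsmul, ← Nat.cast_smul_eq_nsmul ℚ, smul_smul, Nat.cast_choose ℚ hk',
        Nat.succ_sub_succ]
      congr 1
      have := Nat.factorial_ne_zero (c + 1)
      field_simp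
    · intro x hx
      rw [HasAntidiagonal.mem_antidiagonal] at hx
      exact hvan _ _ hx.ge
  rw [hleft, sum_range_antidiagonal_eq_sum_product m h fun a b hab => hvan a b hab.le, coeff_mul]
  have hright : ∀ x ∈ antidiagonal m, coeff x.1 G * coeff x.2 (mk fun m =>
        ∑ k ∈ range (m + 1), ((k + 1).factorial : ℚ)⁻¹ • coeff m (w k))
      = ∑ a ∈ range (m + 1), ∑ k ∈ range (m + 1),
        ((a.factorial : ℚ)⁻¹ * ((k + 1).factorial : ℚ)⁻¹) •
          (coeff x.1 (Z ^ a) * coeff x.2 (w k)) := by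
    intro x hx
    rw [HasAntidiagonal.mem_antidiagonal] at hx
    have e1 : coeff x.1 G = ∑ n ∈ range (m + 1), (n.factorial : ℚ)⁻¹ • coeff x.1 (Z ^ n) := by
      rw [← hG]
      refine sum_subset (range_mono (by omega)) fun k _ hk => ?_
      rw [coeff_pow_eq_zero_of_lt hZ (by simpa using hk), smul_zero]
    have e2 : ∑ k ∈ range (x.2 + 1), ((k + 1).factorial : ℚ)⁻¹ • coeff x.2 (w k)
        = ∑ k ∈ range (m + 1), ((k + 1).factorial : ℚ)⁻¹ • coeff x.2 (w k) := by
      refine sum_subset (range_mono (by omega)) fun k _ hk => ?_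
      rw [mem_range, not_lt] at hk
      rw [hw0 _ _ (by omega), smul_zero]
    rw [coeff_mk, e1, e2, sum_mul_sum]
    simp only [smul_mul_smul_comm]
  rw [sum_congr rfl hright]
  symm
  rw [sum_comm]
  refine sum_congr rfl fun a _ => ?_
  rw [sum_comm]
  refine sum_congr rfl fun k _ => ?_
  simp only [hh]
  rw [coeff_mul, smul_sum]

/-! ### The Baker–Campbell–Hausdorff series is a Lie series -/

theorem coeff_expSeries (x : B) (n : ℕ) :
    coeff n (expSeries x) = (n.factorial : ℚ)⁻¹ • x ^ n := coeff_mk _ _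

theorem euler_expSeries (x : B) : euler (expSeries x) = expSeries x * (C x * X) := by
  ext n
  rw [coeff_euler, ← mul_assoc]
  cases n with
  | zero => simp
  | succ n =>
    rw [coeff_succ_mul_X, coeff_mul_C, coeff_expSeries, coeff_expSeries, smul_mul_assoc,
      ← pow_succ, ← Nat.cast_smul_eq_nsmul ℚ, smul_smul]
    congr 1
    rw [Nat.factorial_succ]
    push_cast
    field_simp

/-- This is the formula for the conjugate `e^{-Ty} x e^{Ty}`, written without an inverse. -/
theorem C_mul_expSeries (x y : B) : C x * expSeries y
    = expSeries y * mk fun n => (n.factorial : ℚ)⁻¹ • iteratedBracket x y n := by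
  ext n
  rw [coeff_C_mul, coeff_expSeries, mul_smul_comm, mul_pow_eq_sum_iteratedBracket, coeff_mul,
    ← Nat.sum_antidiagonal_swap]
  simp only [Prod.fst_swap, Prod.snd_swap, coeff_mk]
  rw [Nat.sum_antidiagonal_eq_sum_range_succ
    (fun k a => coeff a (expSeries y) * ((k.factorial : ℚ)⁻¹ • iteratedBracket x y k)), smul_sum]
  refine sum_congr rfl fun k hk => ?_
  have hk' : k ≤ n := by simpa [Nat.lt_succ_iff] using hk
  rw [coeff_expSeries, smul_mul_smul_comm, ← Nat.cast_smul_eq_nsmul ℚ, smul_smul,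
    Nat.cast_choose ℚ hk']
  congr 1
  have := Nat.factorial_ne_zero n
  field_simp

theorem iteratedBracket_mem (V : Submodule ℚ B)
    (hV : ∀ u ∈ V, ∀ v ∈ V, u * v - v * u ∈ V) {x y : B} (hx : x ∈ V) (hy : y ∈ V) (n : ℕ) :
    iteratedBracket x y n ∈ V := by
  induction n with
  | zero => exact hx
  | succ n ih => exact hV _ ih _ hy

/-- If `e^Z = e^{T x} e^{T y}`, then the coefficients of `Z` lie in the Lie algebra generated by
`x` and `y`. -/
theorem coeff_mem_of_exp_eq (V : Submodule ℚ B) (hV : ∀ u ∈ V, ∀ v ∈ V, u * v - v * u ∈ V)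
    {x y : B} (hx : x ∈ V) (hy : y ∈ V) {Z : B⟦X⟧} (hZ : constantCoeff Z = 0)
    (hG : ∀ m, ∑ n ∈ range (m + 1), (n.factorial : ℚ)⁻¹ • coeff m (Z ^ n)
      = coeff m (expSeries x * expSeries y)) (m : ℕ) : coeff m Z ∈ V := by
  set G := expSeries x * expSeries y with hGdef
  -- The logarithmic derivative of `e^{Tx} e^{Ty}` is `T (e^{-Ty} x e^{Ty} + y)`, whose coefficients
  -- visibly lie in `V`. Comparing it with `euler_exp` and cancelling `G` gives a recursion for `Z`.
  have hE : euler G = G * (X * (mk fun n => (n.factorial : ℚ)⁻¹ • iteratedBracket x y n)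
      + C y * X) := by
    rw [hGdef, euler_mul, euler_expSeries, euler_expSeries, mul_add, ← mul_assoc, mul_assoc _ X,
      ← (commute_X (expSeries y)).eq, ← mul_assoc, mul_assoc _ (C x), C_mul_expSeries]
    congr 1
    · rw [(commute_X _).symm.eq]
      simp only [mul_assoc]
    · simp only [mul_assoc]
  have hφ := mul_left_cancel_of_constantCoeff_eq_one (f := G) (by
    rw [hGdef, map_mul, ← coeff_zero_eq_constantCoeff_apply, ← coeff_zero_eq_constantCoeff_apply,
      coeff_expSeries, coeff_expSeries]
    simp) ((euler_exp hZ hG).symm.trans hE)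
  have h0 : coeff 0 Z = 0 := by simpa using hZ
  induction m using Nat.strong_induction_on with
  | _ m ih =>
    rcases Nat.eq_zero_or_pos m with rfl | hm
    · rw [h0]
      exact V.zero_mem
    have hψ : coeff m (X * (mk fun n => (n.factorial : ℚ)⁻¹ • iteratedBracket x y n)
        + C y * X) ∈ V := by
      obtain ⟨j, rfl⟩ := Nat.exists_eq_succ_of_ne_zero hm.ne'
      rw [map_add, Nat.succ_eq_add_one, coeff_succ_X_mul, coeff_succ_mul_X, coeff_mk, coeff_C]
      refine V.add_mem (V.smul_mem _ (iteratedBracket_mem V hV hx hy _)) ?_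
      split_ifs
      · exact hy
      · exact V.zero_mem
    have hw : ∀ k, ∀ i < m, coeff i (iteratedBracket (euler Z) Z k) ∈ V := by
      intro k
      induction k with
      | zero =>
        intro i hi
        rw [iteratedBracket, coeff_euler]
        exact V.nsmul_mem (ih i hi) _
      | succ k ihk =>
        intro i hi
        rw [iteratedBracket, map_sub, coeff_mul, coeff_mul, ← Nat.sum_antidiagonal_swap,
          ← sum_sub_distrib]
        refine V.sum_mem fun x hx => ?_
        rw [HasAntidiagonal.mem_antidiagonal] at hx
        exact hV _ (ihk _ (by simp; omega)) _ (ih _ (by simp; omega))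
    -- Even in degree `m` the brackets of depth at least `1` involve only coefficients of degree
    -- below `m`, because both factors of the last commutator have zero constant term. The depth `0`
    -- term is `m • coeff m Z`, so the recursion can be solved for `coeff m Z` inside `V`.
    have hw' : ∀ k, coeff m (iteratedBracket (euler Z) Z (k + 1)) ∈ V := by
      intro k
      rw [iteratedBracket, map_sub, coeff_mul, coeff_mul, ← Nat.sum_antidiagonal_swap,
        ← sum_sub_distrib]
      refine V.sum_mem fun x hx => ?_
      rw [HasAntidiagonal.mem_antidiagonal] at hx
      simp only [Prod.fst_swap, Prod.snd_swap]
      rcases Nat.eq_zero_or_pos x.1 with h1 | h1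
      · rw [h1, h0, mul_zero, zero_mul, sub_zero]
        exact V.zero_mem
      rcases Nat.eq_zero_or_pos x.2 with h2 | h2
      · rw [h2, coeff_iteratedBracket_euler_of_lt hZ k 0 (by omega), mul_zero, zero_mul, sub_zero]
        exact V.zero_mem
      · exact hV _ (hw k _ (by omega)) _ (ih _ (by omega))
    rw [← hφ, coeff_mk, sum_range_succ'] at hψ
    have h3 := V.sub_mem hψ (V.sum_mem (t := range m)
      (f := fun k => ((k + 1 + 1).factorial : ℚ)⁻¹ • coeff m (iteratedBracket (euler Z) Z (k + 1)))
      fun k _ => V.smul_mem _ (hw' k))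
    rw [add_sub_cancel_left, iteratedBracket, coeff_euler, ← Nat.cast_smul_eq_nsmul ℚ] at h3
    have h4 := V.smul_mem ((m : ℚ)⁻¹) h3
    have hm' : (m : ℚ) ≠ 0 := by exact_mod_cast hm.ne'
    simpa [smul_smul, hm'] using h4

end Euler

end PowerSeries

/-! ### The `p`-adic filtration -/

section Padic

open Finset

/-- The subgroup `p ^ k M` of `M`. -/
def padicSub (p k : ℕ) (M : Type*) [AddCommGroup M] : AddSubgroup M :=
  (nsmulAddMonoidHom (α := M) (p ^ k)).range

/-- `M` is torsion-free, separated and complete for the filtration `p ^ k M`, and divisible by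
the integers prime to `p`. -/
structure IsPadicComplete (p : ℕ) (M : Type*) [AddCommGroup M] : Prop where
  torsionFree : ∀ n : ℕ, n ≠ 0 → ∀ x : M, n • x = 0 → x = 0
  separated : ∀ x : M, (∀ k, x ∈ padicSub p k M) → x = 0
  complete : ∀ u : ℕ → M, (∀ k, ∃ N, ∀ n, N ≤ n → u (n + 1) - u n ∈ padicSub p k M) →
    ∃ c, PadicTendsto p u c
  divisible : ∀ n : ℕ, ¬ p ∣ n → ∀ x : M, ∃ y, n • y = x

variable {p : ℕ} {M : Type*} [AddCommGroup M]

theorem mem_padicSub {k : ℕ} {x : M} : x ∈ padicSub p k M ↔ ∃ w : M, p ^ k • w = x := Iff.rfl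

theorem smul_mem_padicSub (k : ℕ) (x : M) : p ^ k • x ∈ padicSub p k M := ⟨x, rfl⟩

theorem padicSub_anti {i j : ℕ} (h : i ≤ j) : padicSub p j M ≤ padicSub p i M := by
  rintro _ ⟨w, rfl⟩
  obtain ⟨k, rfl⟩ := Nat.exists_eq_add_of_le h
  exact ⟨p ^ k • w, by simp [pow_add, mul_smul]⟩

theorem mem_padicSub_zero (x : M) : x ∈ padicSub p 0 M := ⟨x, by simp⟩

theorem map_mem_padicSub {M' : Type*} [AddCommGroup M'] (φ : M →+ M') {k : ℕ} {x : M}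
    (hx : x ∈ padicSub p k M) : φ x ∈ padicSub p k M' := by
  obtain ⟨w, rfl⟩ := hx
  exact ⟨φ w, by simp⟩

theorem padicTendsto_iff {u : ℕ → M} {c : M} :
    PadicTendsto p u c ↔ ∀ k, ∃ N, ∀ n, N ≤ n → u n - c ∈ padicSub p k M := by
  unfold PadicTendsto
  simp only [mem_padicSub, eq_comm]

theorem PadicTendsto.mem {u : ℕ → M} {c : M} (h : PadicTendsto p u c) {k : ℕ}
    (hu : ∀ n, u n ∈ padicSub p k M) : c ∈ padicSub p k M := by
  obtain ⟨N, hN⟩ := padicTendsto_iff.mp h k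
  have := sub_mem (hu N) (hN N le_rfl)
  rwa [sub_sub_cancel] at this

theorem PadicTendsto.map {M' : Type*} [AddCommGroup M'] (φ : M →+ M') {u : ℕ → M} {c : M}
    (h : PadicTendsto p u c) : PadicTendsto p (fun n => φ (u n)) (φ c) := by
  rw [padicTendsto_iff] at h ⊢
  intro k
  obtain ⟨N, hN⟩ := h k
  refine ⟨N, fun n hn => ?_⟩
  rw [← map_sub]
  exact map_mem_padicSub φ (hN n hn)

theorem PadicTendsto.sub {u v : ℕ → M} {c d : M} (hu : PadicTendsto p u c)
    (hv : PadicTendsto p v d) : PadicTendsto p (fun n => u n - v n) (c - d) := by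
  rw [padicTendsto_iff] at hu hv ⊢
  intro k
  obtain ⟨N, hN⟩ := hu k
  obtain ⟨N', hN'⟩ := hv k
  refine ⟨max N N', fun n hn => ?_⟩
  rw [sub_sub_sub_comm]
  exact sub_mem (hN n (le_trans (le_max_left _ _) hn)) (hN' n (le_trans (le_max_right _ _) hn))

theorem padicTendsto_const (c : M) : PadicTendsto p (fun _ => c) c := by
  rw [padicTendsto_iff]
  intro k
  exact ⟨0, fun n _ => by simp⟩

theorem padicTendsto_congr {u v : ℕ → M} {c : M} {N : ℕ} (huv : ∀ n, N ≤ n → u n = v n)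
    (h : PadicTendsto p u c) : PadicTendsto p v c := by
  intro k
  obtain ⟨N', hN'⟩ := h k
  refine ⟨max N N', fun n hn => ?_⟩
  rw [← huv n (le_trans (le_max_left _ _) hn)]
  exact hN' n (le_trans (le_max_right _ _) hn)

theorem IsPadicComplete.tendsto_unique (hM : IsPadicComplete p M) {u : ℕ → M} {c d : M}
    (hc : PadicTendsto p u c) (hd : PadicTendsto p u d) : c = d := by
  rw [← sub_eq_zero]
  refine hM.separated _ fun k => (hc.sub hd).mem fun n => ?_
  simp

theorem IsPadicComplete.smul_cancel (hM : IsPadicComplete p M) {n : ℕ} (hn : n ≠ 0) {x y : M}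
    (h : n • x = n • y) : x = y := by
  rw [← sub_eq_zero]
  exact hM.torsionFree n hn _ (by rw [smul_sub, h, sub_self])

/-! ### Division by integers in a `p`-adically complete group -/

section Division

variable [Fact p.Prime]

/-- Write `N = p ^ v * m` with `m` prime to `p`: division by `m` is free, and division by `p ^ v`
uses up `v` steps of the filtration. -/
theorem IsPadicComplete.exists_smul_eq (hM : IsPadicComplete p M) {N : ℕ} (hN : N ≠ 0) {j : ℕ}
    {x : M} (hx : x ∈ padicSub p (padicValNat p N + j) M) :
    ∃ w ∈ padicSub p j M, N • w = x := by
  obtain ⟨y, rfl⟩ := hx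
  obtain ⟨m, hm⟩ := pow_padicValNat_dvd (p := p) (n := N)
  have hpm : ¬ p ∣ m := by
    rintro ⟨r, rfl⟩
    refine pow_succ_padicValNat_not_dvd (p := p) hN ⟨r, ?_⟩
    rw [pow_succ, mul_assoc]
    exact hm
  obtain ⟨z, hz⟩ := hM.divisible m hpm y
  refine ⟨p ^ j • z, smul_mem_padicSub j z, ?_⟩
  subst hz
  simp only [nsmulAddMonoidHom_apply]
  conv_lhs => rw [hm]
  rw [smul_smul, smul_smul, pow_add]
  congr 1
  ring

theorem IsPadicComplete.mem_of_smul_mem (hM : IsPadicComplete p M) {N : ℕ} (hN : N ≠ 0) {j : ℕ}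
    {w : M} (hw : N • w ∈ padicSub p (padicValNat p N + j) M) : w ∈ padicSub p j M := by
  obtain ⟨w', hw', he⟩ := hM.exists_smul_eq hN hw
  rwa [hM.smul_cancel hN he] at hw'

end Division

/-! ### Convergent series -/

/-- The series `∑ f n` converges `p`-adically to `s`. -/
def HasPadicSum (p : ℕ) (f : ℕ → M) (s : M) : Prop :=
  PadicTendsto p (fun N => ∑ n ∈ range N, f n) s

/-- The sequence `f` converges `p`-adically to `0`. -/
def IsPadicNull (p : ℕ) (f : ℕ → M) : Prop :=
  ∀ k, ∃ N, ∀ n, N ≤ n → f n ∈ padicSub p k M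

theorem HasPadicSum.isPadicNull {f : ℕ → M} {s : M} (h : HasPadicSum p f s) :
    IsPadicNull p f := by
  intro k
  obtain ⟨N, hN⟩ := padicTendsto_iff.mp h k
  refine ⟨N, fun n hn => ?_⟩
  have := sub_mem (hN (n + 1) (by omega)) (hN n hn)
  rwa [sub_sub_sub_cancel_right, sum_range_succ, add_sub_cancel_left] at this

theorem IsPadicNull.exists_hasPadicSum (hM : IsPadicComplete p M) {f : ℕ → M}
    (h : IsPadicNull p f) : ∃ s, HasPadicSum p f s := by
  refine hM.complete _ fun k => ?_
  obtain ⟨N, hN⟩ := h k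
  refine ⟨N, fun n hn => ?_⟩
  rw [sum_range_succ, add_sub_cancel_left]
  exact hN n hn

theorem HasPadicSum.mem {f : ℕ → M} {s : M} (h : HasPadicSum p f s) {k : ℕ}
    (hf : ∀ n, f n ∈ padicSub p k M) : s ∈ padicSub p k M :=
  PadicTendsto.mem h fun _ => sum_mem fun n _ => hf n

theorem HasPadicSum.map {M' : Type*} [AddCommGroup M'] (φ : M →+ M') {f : ℕ → M} {s : M}
    (h : HasPadicSum p f s) : HasPadicSum p (fun n => φ (f n)) (φ s) := by
  have := PadicTendsto.map φ h
  simp only [map_sum] at this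
  exact this

theorem HasPadicSum.sub {f g : ℕ → M} {s t : M} (hf : HasPadicSum p f s)
    (hg : HasPadicSum p g t) : HasPadicSum p (fun n => f n - g n) (s - t) := by
  have := PadicTendsto.sub hf hg
  simp only [← sum_sub_distrib] at this
  exact this

theorem hasPadicSum_of_eventually_zero {f : ℕ → M} {N : ℕ} (h : ∀ n, N ≤ n → f n = 0) :
    HasPadicSum p f (∑ n ∈ range N, f n) := by
  refine padicTendsto_congr (N := N) (fun n hn => ?_) (padicTendsto_const _)
  exact sum_subset (range_mono hn) fun k _ hk => h k (by simpa using hk)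

theorem hasPadicSum_zero : HasPadicSum p (fun _ => (0 : M)) 0 := by
  simpa using hasPadicSum_of_eventually_zero (p := p) (f := fun _ => (0 : M)) (N := 0) (by simp)

theorem hasPadicSum_sum {ι : Type*} (I : Finset ι) {f : ι → ℕ → M} {s : ι → M}
    (h : ∀ i, HasPadicSum p (f i) (s i)) :
    HasPadicSum p (fun n => ∑ i ∈ I, f i n) (∑ i ∈ I, s i) := by
  classical
  induction I using Finset.induction_on with
  | empty => simpa using hasPadicSum_zero
  | insert i I hi ih =>
    have := (h i).sub (ih.map (-AddMonoidHom.id M))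
    simpa [sum_insert hi] using this

section Ring

variable {D : Type*} [Ring D]

theorem mul_mem_padicSub {i j : ℕ} {x y : D} (hx : x ∈ padicSub p i D)
    (hy : y ∈ padicSub p j D) : x * y ∈ padicSub p (i + j) D := by
  obtain ⟨x, rfl⟩ := hx
  obtain ⟨y, rfl⟩ := hy
  exact ⟨x * y, by
    simp only [nsmulAddMonoidHom_apply, smul_mul_smul_comm, pow_add]⟩

theorem mul_mem_padicSub_left {j : ℕ} (x : D) {y : D} (hy : y ∈ padicSub p j D) :
    x * y ∈ padicSub p j D := by
  simpa using mul_mem_padicSub (mem_padicSub_zero x) hy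

theorem mul_mem_padicSub_right {j : ℕ} {x : D} (hx : x ∈ padicSub p j D) (y : D) :
    x * y ∈ padicSub p j D := by
  simpa using mul_mem_padicSub hx (mem_padicSub_zero y)

theorem pow_mem_padicSub {i : ℕ} {x : D} (hx : x ∈ padicSub p i D) (n : ℕ) :
    x ^ n ∈ padicSub p (i * n) D := by
  induction n with
  | zero => simpa using mem_padicSub_zero _
  | succ n ih =>
    rw [pow_succ, mul_add, mul_one]
    exact mul_mem_padicSub ih hx

open PowerSeries in
theorem HasPadicSum.mul {f g : PowerSeries D} {s t : D}
    (hf : HasPadicSum p (fun n => coeff n f) s) (hg : HasPadicSum p (fun n => coeff n g) t) :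
    HasPadicSum p (fun n => coeff n (f * g)) (s * t) := by
  refine padicTendsto_iff.mpr fun k => ?_
  obtain ⟨N1, h1⟩ := hf.isPadicNull k
  obtain ⟨N2, h2⟩ := hg.isPadicNull k
  obtain ⟨N3, h3⟩ := padicTendsto_iff.mp hf k
  obtain ⟨N4, h4⟩ := padicTendsto_iff.mp hg k
  refine ⟨N1 + N2 + N3 + N4 + 1, fun N hN => ?_⟩
  obtain ⟨n, rfl⟩ := Nat.exists_eq_succ_of_ne_zero (show N ≠ 0 by omega)
  -- Modulo `p ^ k` a product of coefficients whose indices add up to more than `n ≥ N1 + N2`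
  -- vanishes, since one of the two indices is past its threshold. So the triangular and the square
  -- partial sums agree.
  have key : ∑ m ∈ range (n + 1), coeff m (f * g)
      - (∑ m ∈ range (n + 1), coeff m f) * (∑ m ∈ range (n + 1), coeff m g) ∈ padicSub p k D := by
    rw [← QuotientAddGroup.eq_zero_iff, QuotientAddGroup.mk_sub, sub_eq_zero, sum_mul_sum]
    have := sum_range_antidiagonal_eq_sum_product n
      (fun a b => ((coeff a f * coeff b g : D) : D ⧸ padicSub p k D)) (fun a b hab => by
        rw [QuotientAddGroup.eq_zero_iff]
        rcases le_or_gt N1 a with h | h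
        · exact mul_mem_padicSub_right (h1 a h) _
        · exact mul_mem_padicSub_left _ (h2 b (by omega)))
    simp only [← QuotientAddGroup.mk'_apply (padicSub p k D), ← map_sum] at this ⊢
    simp only [coeff_mul]
    exact this
  have h5 := mul_mem_padicSub_right (h3 (n + 1) (by omega)) (∑ m ∈ range (n + 1), coeff m g)
  have h6 := mul_mem_padicSub_left s (h4 (n + 1) (by omega))
  have h7 := add_mem key (add_mem h5 h6)
  convert h7 using 1
  noncomm_ring

open PowerSeries in
theorem HasPadicSum.pow {f : PowerSeries D} {s : D}
    (hf : HasPadicSum p (fun n => coeff n f) s) (n : ℕ) :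
    HasPadicSum p (fun m => coeff m (f ^ n)) (s ^ n) := by
  induction n with
  | zero =>
    have := hasPadicSum_of_eventually_zero (p := p) (f := fun m => coeff m (1 : PowerSeries D))
      (N := 1) (fun m hm => by simp [coeff_one, show m ≠ 0 by omega])
    simpa using this
  | succ n ih =>
    rw [pow_succ, pow_succ]
    exact ih.mul hf

open PowerSeries in
theorem coeff_mul_mem_padicSub {f g : PowerSeries D} {i j : ℕ}
    (hf : ∀ n, coeff n f ∈ padicSub p i D) (hg : ∀ n, coeff n g ∈ padicSub p j D) (n : ℕ) :
    coeff n (f * g) ∈ padicSub p (i + j) D := by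
  rw [coeff_mul]
  exact sum_mem fun x _ => mul_mem_padicSub (hf _) (hg _)

open PowerSeries in
theorem coeff_pow_mem_padicSub {f : PowerSeries D} {i : ℕ}
    (hf : ∀ n, coeff n f ∈ padicSub p i D) (k n : ℕ) :
    coeff n (f ^ k) ∈ padicSub p (i * k) D := by
  induction k generalizing n with
  | zero => simpa using mem_padicSub_zero _
  | succ k ih =>
    rw [pow_succ, mul_add, mul_one]
    exact coeff_mul_mem_padicSub ih hf n

end Ring

/-! ### Valuations of factorials -/

/-- The exponent of `p` in `boldP p`. -/
def boldExp (p : ℕ) : ℕ := if p = 2 then 2 else 1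

theorem pow_boldExp (p : ℕ) : p ^ boldExp p = boldP p := by
  unfold boldExp boldP
  split_ifs with h
  · subst h
    norm_num
  · simp

variable [hp : Fact p.Prime]

/-- Legendre's formula gives `(p - 1) v_p(n!) < n`, and `p - 1 ≥ 2` for odd `p`. The next three
bounds are the forms needed: a gain that grows with `n` (convergence), terms that stay in `𝐩D`, and
one extra factor `p` from degree `2` on (injectivity of the exponential). -/
theorem factorial_valuation_bound {n : ℕ} (hn : n ≠ 0) :
    if p = 2 then padicValNat p n.factorial + 1 ≤ n else 2 * padicValNat p n.factorial + 1 ≤ n := by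
  have h := sub_one_mul_padicValNat_factorial_lt_of_ne_zero p hn
  split_ifs with h2
  · subst h2
    omega
  · have h3 : 2 ≤ p - 1 := by
      have := hp.out.two_le
      omega
    have := Nat.mul_le_mul_right (padicValNat p n.factorial) h3
    omega

theorem factorial_valuation_two_mul {n : ℕ} (hn : n ≠ 0) :
    2 * padicValNat p n.factorial + n ≤ 2 * (boldExp p * n) := by
  have h := factorial_valuation_bound (p := p) hn
  unfold boldExp
  split_ifs at h ⊢ <;> omega

theorem factorial_valuation_add_boldExp {n : ℕ} (hn : n ≠ 0) :
    padicValNat p n.factorial + boldExp p ≤ boldExp p * n := by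
  have h := factorial_valuation_bound (p := p) hn
  unfold boldExp
  split_ifs at h ⊢ <;> omega

/-- This is where `p = 2` needs `𝐩 = 4`: with exponent `1` in place of `2` the inequality fails at
`n = 2`. -/
theorem factorial_valuation_add_boldExp_lt {n : ℕ} (hn : 2 ≤ n) :
    padicValNat p n.factorial + 1 + boldExp p ≤ boldExp p * n := by
  have h := factorial_valuation_bound (p := p) (show n ≠ 0 by omega)
  unfold boldExp
  split_ifs at h ⊢
  · omega
  · omega

theorem padicValNat_le_factorial {n : ℕ} (hn : n ≠ 0) :
    padicValNat p n ≤ padicValNat p n.factorial :=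
  (padicValNat_dvd_iff_le n.factorial_ne_zero).mp
    (pow_padicValNat_dvd.trans (Nat.dvd_factorial (Nat.pos_of_ne_zero hn) le_rfl))

end Padic

/-! ### The `p`-adic exponential and logarithm -/

section PadicExp

open Finset PowerSeries

variable {p : ℕ} {D : Type*} [Ring D]

theorem sum_Icc_one_eq_sum_range {M : Type*} [AddCommMonoid M] (f : ℕ → M) (n : ℕ) :
    ∑ k ∈ Icc 1 n, f k = ∑ k ∈ range n, f (k + 1) := by
  rw [range_eq_Ico, sum_Ico_add' f 0 n 1]
  refine sum_congr ?_ fun _ _ => rfl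
  ext k
  simp only [mem_Icc, mem_Ico]
  omega

theorem IsPadicExp.unique (hD : IsPadicComplete p D) {a s t : D} (hs : IsPadicExp p a s)
    (ht : IsPadicExp p a t) : s = t := by
  obtain ⟨u, hu, hus⟩ := hs
  obtain ⟨v, hv, hvt⟩ := ht
  obtain rfl : u = v := funext fun n =>
    hD.smul_cancel n.factorial_ne_zero ((hu n).trans (hv n).symm)
  exact hD.tendsto_unique hus hvt

/-- In the telescoping expansion each summand has one factor `a - b` and `n` factors from `{a, b}`.
-/
theorem pow_sub_pow_mem_padicSub {a b : D} {c k : ℕ} (ha : a ∈ padicSub p c D)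
    (hb : b ∈ padicSub p c D) (hab : a - b ∈ padicSub p k D) (n : ℕ) :
    a ^ (n + 1) - b ^ (n + 1) ∈ padicSub p (k + c * n) D := by
  induction n with
  | zero => simpa using hab
  | succ n ih =>
    have h1 := mul_mem_padicSub (pow_mem_padicSub ha (n + 1)) hab
    have h2 := mul_mem_padicSub ih hb
    rw [show c * (n + 1) + k = k + c * (n + 1) by ring] at h1
    rw [show k + c * n + c = k + c * (n + 1) by ring] at h2
    convert add_mem h1 h2 using 1
    rw [pow_succ a (n + 1), pow_succ b (n + 1)]
    noncomm_ring

/-- Torsion-free abelian groups are flat over `ℤ`, so identities in `D` may be checked in `ℚ ⊗ D`,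
where formal exponentials and logarithms exist. -/
theorem injective_includeRight (hD : IsPadicComplete p D) :
    Function.Injective (Algebra.TensorProduct.includeRight : D →ₐ[ℤ] ℚ ⊗[ℤ] D) := by
  have : IsAddTorsionFree D := ⟨fun n hn x y h => hD.smul_cancel hn h⟩
  have : Module.Flat ℤ D := inferInstance
  exact Algebra.TensorProduct.includeRight_injective (Int.cast_injective (α := ℚ))

theorem expTerm_mul_expTerm (hD : IsPadicComplete p D) {a : D} {u : ℕ → D}
    (hu : ∀ n, n.factorial • u n = a ^ n) (i j : ℕ) :
    u i * u j = (i + j).choose i • u (i + j) := by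
  refine hD.smul_cancel (mul_ne_zero i.factorial_ne_zero j.factorial_ne_zero) ?_
  rw [← smul_mul_smul_comm, hu, hu, ← pow_add, ← hu, smul_smul,
    ← Nat.add_choose_mul_factorial_mul_factorial i j,
    Nat.choose_symm_add]
  congr 1
  ring

/-- This is `(e^a)^m = e^{ma}`: multiplying by `e^a` turns `m^n` into `(m + 1)^n` through the
binomial theorem for the divided powers `u n`. -/
theorem HasPadicSum.expTerm_pow (hD : IsPadicComplete p D) {a t : D} {u : ℕ → D}
    (hu : ∀ n, n.factorial • u n = a ^ n) (ht : HasPadicSum p u t) (m : ℕ) :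
    HasPadicSum p (fun n => m ^ n • u n) (t ^ m) := by
  have h0 : u 0 = 1 := by simpa using hu 0
  induction m with
  | zero =>
    have := hasPadicSum_of_eventually_zero (p := p) (f := fun n => 0 ^ n • u n) (N := 1)
      (fun n hn => by simp [show n ≠ 0 by omega])
    simpa [h0] using this
  | succ m ih =>
    have := HasPadicSum.mul (f := mk fun n => m ^ n • u n) (g := mk u) (s := t ^ m) (t := t)
      (by simpa only [coeff_mk] using ih) (by simpa only [coeff_mk] using ht)
    rw [pow_succ]
    convert this using 2 with n
    rw [coeff_mul, Commute.add_pow' (Commute.one_right m), sum_smul]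
    refine sum_congr rfl fun x hx => ?_
    rw [HasAntidiagonal.mem_antidiagonal] at hx
    rw [coeff_mk, coeff_mk, smul_mul_assoc, expTerm_mul_expTerm hD hu, smul_smul, hx]
    simp [mul_comm]

/-- `(e^a) ^ (p ^ k) = 1 + p ^ k a` up to multiples of `p ^ (2 k)`. -/
theorem IsPadicExp.pow_sub_mem (hD : IsPadicComplete p D) {a t : D} (h : IsPadicExp p a t)
    (k : ℕ) : t ^ p ^ k - 1 - p ^ k • a ∈ padicSub p (2 * k) D := by
  obtain ⟨u, hu, ht⟩ := h
  obtain ⟨N, hN⟩ := padicTendsto_iff.mp (HasPadicSum.expTerm_pow hD hu ht (p ^ k)) (2 * k)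
  have h0 : u 0 = 1 := by simpa using hu 0
  have h1 : u 1 = a := by simpa using hu 1
  have h3 := hN (N + 2) (by omega)
  rw [sum_range_succ', sum_range_succ', h0, zero_add, h1, pow_zero, pow_one, one_smul] at h3
  have h4 : ∑ n ∈ range N, (p ^ k) ^ (n + 1 + 1) • u (n + 1 + 1) ∈ padicSub p (2 * k) D := by
    refine sum_mem fun n _ => ⟨(p ^ k) ^ n • u (n + 1 + 1), ?_⟩
    rw [nsmulAddMonoidHom_apply, smul_smul]
    congr 1
    ring
  convert sub_mem h4 h3 using 1
  abel

variable [Fact p.Prime]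

theorem expTerm_mem (hD : IsPadicComplete p D) {a u : D} (ha : a ∈ padicSub p (boldExp p) D)
    {n j : ℕ} (hu : n.factorial • u = a ^ n)
    (hj : padicValNat p n.factorial + j ≤ boldExp p * n) : u ∈ padicSub p j D := by
  refine hD.mem_of_smul_mem n.factorial_ne_zero ?_
  rw [hu]
  exact padicSub_anti hj (pow_mem_padicSub ha n)

theorem exists_expTerm (hD : IsPadicComplete p D) {a : D} (ha : a ∈ padicSub p (boldExp p) D) :
    ∃ u : ℕ → D, ∀ n, n.factorial • u n = a ^ n := by
  choose u hu using fun n : ℕ => hD.exists_smul_eq n.factorial_ne_zero (j := 0)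
    (padicSub_anti (by
      rcases eq_or_ne n 0 with rfl | hn
      · simp
      · have := factorial_valuation_add_boldExp (p := p) hn
        omega) (pow_mem_padicSub ha n))
  exact ⟨u, fun n => (hu n).2⟩

theorem isPadicNull_of_forall_mem {M : Type*} [AddCommGroup M] {f : ℕ → M}
    (h : ∀ n j, padicValNat p n.factorial + j ≤ boldExp p * n → f n ∈ padicSub p j M) :
    IsPadicNull p f := by
  intro k
  -- The bound `2 v_p(n!) + n ≤ 2 (boldExp p * n)` leaves at least `n / 2` factors of `p` after
  -- division by `n!`; the `+ 1` keeps `n` nonzero.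
  refine ⟨2 * k + 1, fun n hn => h n k ?_⟩
  have := factorial_valuation_two_mul (p := p) (show n ≠ 0 by omega)
  omega

theorem exists_isPadicExp (hD : IsPadicComplete p D) {a : D}
    (ha : a ∈ padicSub p (boldExp p) D) : ∃ t, IsPadicExp p a t := by
  obtain ⟨u, hu⟩ := exists_expTerm hD ha
  obtain ⟨t, ht⟩ := (isPadicNull_of_forall_mem (p := p) (f := u)
    fun n j hj => expTerm_mem hD ha (hu n) hj).exists_hasPadicSum hD
  exact ⟨t, u, hu, ht⟩

/-- If `a ≡ b` modulo `p ^ k`, then the terms of degree at least `2` of the two exponentials agree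
modulo `p ^ (k + 1)`. As the sums are equal, the linear terms must agree modulo `p ^ (k + 1)` too,
and separatedness concludes. -/
theorem IsPadicExp.injective (hD : IsPadicComplete p D) {a b t : D}
    (ha : a ∈ padicSub p (boldExp p) D) (hb : b ∈ padicSub p (boldExp p) D)
    (hat : IsPadicExp p a t) (hbt : IsPadicExp p b t) : a = b := by
  obtain ⟨u, hu, hut⟩ := hat
  obtain ⟨v, hv, hvt⟩ := hbt
  rw [← sub_eq_zero]
  refine hD.separated _ fun k => ?_
  induction k with
  | zero => exact mem_padicSub_zero _
  | succ k ih =>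
    have hterm : ∀ n, u (n + 2) - v (n + 2) ∈ padicSub p (k + 1) D := by
      intro n
      refine hD.mem_of_smul_mem (n + 2).factorial_ne_zero ?_
      rw [smul_sub, hu, hv]
      refine padicSub_anti ?_ (pow_sub_pow_mem_padicSub ha hb ih (n + 1))
      have := factorial_valuation_add_boldExp_lt (p := p) (show 2 ≤ n + 2 by omega)
      rw [show boldExp p * (n + 2) = boldExp p * (n + 1) + boldExp p by ring] at this
      omega
    have h0 : u 0 - v 0 = 0 := by
      have h1 := hu 0
      have h2 := hv 0
      simp only [Nat.factorial_zero, one_smul, pow_zero] at h1 h2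
      rw [h1, h2, sub_self]
    have h1 : u 1 - v 1 = a - b := by
      have h1 := hu 1
      have h2 := hv 1
      simp only [Nat.factorial_one, one_smul, pow_one] at h1 h2
      rw [h1, h2]
    obtain ⟨N, hN⟩ := padicTendsto_iff.mp (HasPadicSum.sub hut hvt) (k + 1)
    have h3 := hN (N + 2) (by omega)
    rw [sum_range_succ', sum_range_succ', h0, zero_add, h1, sub_self, sub_zero, add_zero] at h3
    have hsum : ∑ n ∈ range N, (u (n + 1 + 1) - v (n + 1 + 1)) ∈ padicSub p (k + 1) D :=
      sum_mem fun n _ => hterm n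
    have h4 := sub_mem h3 hsum
    rwa [add_sub_cancel_left] at h4

/-- The logarithm of a convergent series `G ≡ 1` modulo `𝐩`: there is a convergent series
`Z = log G`, and `e^Z = G` holds for the sums. -/
theorem exists_log (hD : IsPadicComplete p D) {Q : Type*} [Ring Q] [Algebra ℚ Q] (ι : D →+* Q)
    (hι : Function.Injective ι) {G : D⟦X⟧} (hG0 : constantCoeff G = 1)
    (hG : ∀ n, coeff n (G - 1) ∈ padicSub p (boldExp p) D) {g : D}
    (hg : HasPadicSum p (fun n => coeff n G) g) :
    ∃ (Z : D⟦X⟧) (z : D), (∀ n, coeff n Z ∈ padicSub p (boldExp p) D) ∧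
      PowerSeries.map ι Z = seriesComp (log ℚ) (PowerSeries.map ι (G - 1)) ∧
      HasPadicSum p (fun n => coeff n Z) z ∧ IsPadicExp p z g := by
  set U := G - 1 with hU
  have hU0 : constantCoeff U = 0 := by simp [hU, hG0]
  have hUsum : HasPadicSum p (fun n => coeff n U) (g - 1) := by
    have := HasPadicSum.pow hg 0
    rw [pow_zero, pow_zero] at this
    simpa [hU] using hg.sub this
  have hι0 : constantCoeff (PowerSeries.map ι U) = 0 := by
    rw [← coeff_zero_eq_constantCoeff_apply, coeff_map, coeff_zero_eq_constantCoeff_apply, hU0,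
      map_zero]
  -- the terms of the logarithm
  have hℓ : ∀ k n : ℕ, ∃ w : D, k ≠ 0 → k • w = (-1) ^ (k + 1) * coeff n (U ^ k) := by
    intro k n
    rcases eq_or_ne k 0 with rfl | hk
    · exact ⟨0, fun h => absurd rfl h⟩
    · obtain ⟨w, -, hw⟩ := hD.exists_smul_eq hk (j := 0) (padicSub_anti (by
        have h1 := factorial_valuation_add_boldExp (p := p) hk
        have h2 := padicValNat_le_factorial (p := p) hk
        omega) (mul_mem_padicSub_left ((-1) ^ (k + 1)) (coeff_pow_mem_padicSub hG k n)))
      exact ⟨w, fun _ => hw⟩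
  choose ℓ hℓ using hℓ
  have hℓmem : ∀ k n j, k ≠ 0 → padicValNat p k.factorial + j ≤ boldExp p * k →
      ℓ k n ∈ padicSub p j D := by
    intro k n j hk hj
    refine hD.mem_of_smul_mem hk ?_
    rw [hℓ k n hk]
    refine mul_mem_padicSub_left _ (padicSub_anti ?_ (coeff_pow_mem_padicSub hG k n))
    have h2 := padicValNat_le_factorial (p := p) hk
    omega
  -- For fixed `k` the coefficients of `U ^ k` tend to `0` because its series converges, and
  -- dividing by `k` costs a fixed power of `p`.
  have hℓnull : ∀ k, k ≠ 0 → IsPadicNull p (ℓ k) := by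
    intro k hk j
    obtain ⟨N, hN⟩ := (hUsum.pow k).isPadicNull (padicValNat p k + j)
    refine ⟨N, fun n hn => hD.mem_of_smul_mem hk ?_⟩
    rw [hℓ k n hk]
    exact mul_mem_padicSub_left _ (hN n hn)
  set Z : D⟦X⟧ := mk fun n => ∑ k ∈ range n, ℓ (k + 1) n with hZ
  have hZmem : ∀ n, coeff n Z ∈ padicSub p (boldExp p) D := by
    intro n
    rw [hZ, coeff_mk]
    exact sum_mem fun k _ =>
      hℓmem _ _ _ k.succ_ne_zero (factorial_valuation_add_boldExp k.succ_ne_zero)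
  have hZ0 : constantCoeff Z = 0 := by
    rw [← coeff_zero_eq_constantCoeff_apply, hZ, coeff_mk, range_zero, sum_empty]
  have hZnull : IsPadicNull p fun n => coeff n Z := by
    intro j
    choose! N hN using fun k (hk : k ≠ 0) => hℓnull k hk j
    -- For `k ≥ 2j` the term lies in `p ^ j D` by the valuation bound alone. Only finitely many `k`
    -- remain, and the sum of their thresholds dominates each of them.
    refine ⟨∑ k ∈ range (2 * j), N (k + 1), fun n hn => ?_⟩
    simp only [hZ, coeff_mk]
    refine sum_mem fun k _ => ?_
    rcases lt_or_ge k (2 * j) with h | h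
    · exact hN _ k.succ_ne_zero _ (le_trans (single_le_sum
        (f := fun k => N (k + 1)) (fun _ _ => Nat.zero_le _) (mem_range.mpr h)) hn)
    · refine hℓmem _ _ _ k.succ_ne_zero ?_
      have := factorial_valuation_two_mul (p := p) (show k + 1 ≠ 0 by omega)
      omega
  have hmap : PowerSeries.map ι Z = seriesComp (log ℚ) (PowerSeries.map ι U) := by
    ext n
    rw [coeff_map, hZ, coeff_mk, map_sum, seriesComp, coeff_mk, sum_range_succ']
    simp only [coeff_log, if_true, zero_smul, add_zero, Nat.succ_ne_zero, if_false]
    refine sum_congr rfl fun k _ => ?_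
    have h1 := congrArg ι (hℓ (k + 1) n k.succ_ne_zero)
    rw [map_nsmul, map_mul, map_pow, map_neg, map_one, ← coeff_map, map_pow] at h1
    have hk : ((k + 1 : ℕ) : ℚ) ≠ 0 := by exact_mod_cast k.succ_ne_zero
    have h2 : ι (ℓ (k + 1) n) = ((k + 1 : ℕ) : ℚ)⁻¹ • (((k + 1 : ℕ) : ℚ) • ι (ℓ (k + 1) n)) := by
      rw [smul_smul, inv_mul_cancel₀ hk, one_smul]
    rw [h2, Nat.cast_smul_eq_nsmul, h1, Algebra.algebraMap_self_apply, div_eq_inv_mul, mul_smul]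
    congr 1
    rw [Algebra.smul_def]
    congr 1
    simp
  obtain ⟨z, hz⟩ := hZnull.exists_hasPadicSum hD
  refine ⟨Z, z, hZmem, hmap, hz, ?_⟩
  -- the exponential of `Z`
  have hzmem : z ∈ padicSub p (boldExp p) D := hz.mem hZmem
  -- `e n m` is the coefficient of `T^m` in `Z^n / n!`. Summing the array over `m` gives `z^n / n!`,
  -- summing it over `n` gives the coefficients of `G`; the rest of the proof exchanges the two
  -- summations.
  choose e he using fun n m : ℕ => hD.exists_smul_eq n.factorial_ne_zero (j := 0)
    (padicSub_anti (by
      rcases eq_or_ne n 0 with rfl | hn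
      · simp
      · have := factorial_valuation_add_boldExp (p := p) hn
        omega) (coeff_pow_mem_padicSub hZmem n m))
  have hemem : ∀ n m j, padicValNat p n.factorial + j ≤ boldExp p * n →
      e n m ∈ padicSub p j D := by
    intro n m j hj
    refine hD.mem_of_smul_mem n.factorial_ne_zero ?_
    rw [(he n m).2]
    exact padicSub_anti hj (coeff_pow_mem_padicSub hZmem n m)
  have henull : ∀ n, IsPadicNull p (e n) := by
    intro n j
    obtain ⟨N, hN⟩ := (hz.pow n).isPadicNull (padicValNat p n.factorial + j)
    refine ⟨N, fun m hm => hD.mem_of_smul_mem n.factorial_ne_zero ?_⟩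
    rw [(he n m).2]
    exact hN m hm
  choose u hu using fun n => (henull n).exists_hasPadicSum hD
  have huz : ∀ n, n.factorial • u n = z ^ n := by
    intro n
    have h1 := (hu n).map (nsmulAddMonoidHom (α := D) n.factorial)
    simp only [nsmulAddMonoidHom_apply, (he n _).2] at h1
    exact hD.tendsto_unique h1 (hz.pow n)
  have hevan : ∀ n m, m < n → e n m = 0 := by
    intro n m hmn
    refine hD.torsionFree _ n.factorial_ne_zero _ ?_
    rw [(he n m).2, coeff_pow_eq_zero_of_lt hZ0 hmn]
  have hGe : ∀ m, coeff m G = ∑ n ∈ range (m + 1), e n m := by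
    intro m
    apply hι
    have h1 := sum_coeff_seriesComp_log_pow hι0 m
    rw [← hmap] at h1
    rw [show G = 1 + U by simp [hU], ← coeff_map, map_add, map_one, ← h1, map_sum]
    refine sum_congr rfl fun n _ => ?_
    rw [← map_pow, coeff_map, ← (he n m).2, map_nsmul, ← Nat.cast_smul_eq_nsmul ℚ, smul_smul,
      inv_mul_cancel₀ (by exact_mod_cast n.factorial_ne_zero), one_smul]
  refine ⟨u, huz, padicTendsto_iff.mpr fun j => ⟨2 * j, fun N hN => ?_⟩⟩
  -- The error after `N` terms is a sum over `m` of minus the tails `n ≥ N` of the array, and these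
  -- lie in `p ^ j D` once `N ≥ 2j`. The range is lengthened to `N + m + 1`, harmlessly since `e n m
  -- = 0` for `n > m`, so that it contains `range N`.
  refine ((hasPadicSum_sum (range N) hu).sub hg).mem fun m => ?_
  have hGe' : coeff m G = ∑ n ∈ range (N + m + 1), e n m := by
    rw [hGe]
    exact sum_subset (range_mono (by omega)) fun n _ hn => hevan n m (by simpa using hn)
  rw [hGe', add_assoc, sum_range_add, sub_add_cancel_left, neg_mem_iff]
  refine sum_mem fun n _ => hemem _ _ _ ?_
  rcases eq_or_ne (N + n) 0 with h0 | h0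
  · rw [h0, show j = 0 by omega]
    simp
  · have := factorial_valuation_two_mul (p := p) h0
    omega

/-- Every element of `1 + 𝐩 D` is an exponential. -/
theorem exists_isPadicExp_eq (hD : IsPadicComplete p D) {s : D}
    (hs : s - 1 ∈ padicSub p (boldExp p) D) :
    ∃ a ∈ padicSub p (boldExp p) D, IsPadicExp p a s := by
  have hcoeff : ∀ n, coeff n (1 + C (s - 1) * X : D⟦X⟧)
      = if n = 0 then 1 else if n = 1 then s - 1 else 0 := by
    intro n
    rcases n with _ | _ | n <;> simp [coeff_one]
  -- The polynomial `1 + (s - 1) T` is used as `G`; summing its coefficients sets `T = 1` and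
  -- returns `s`.
  obtain ⟨Z, z, hZ, -, hz, hexp⟩ := exists_log hD
    (Algebra.TensorProduct.includeRight : D →ₐ[ℤ] ℚ ⊗[ℤ] D).toRingHom (injective_includeRight hD)
    (G := 1 + C (s - 1) * X) (g := s) (by simp) (by
      intro n
      rw [map_sub, hcoeff, coeff_one]
      split_ifs
      · simp
      · simpa using hs
      · simp) (by
      have := hasPadicSum_of_eventually_zero (p := p)
        (f := fun n => coeff n (1 + C (s - 1) * X : D⟦X⟧)) (N := 2) (fun n hn => by
          rw [hcoeff, if_neg (by omega), if_neg (by omega)])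
      rw [sum_range_succ, sum_range_one, hcoeff, hcoeff] at this
      simpa using this)
  exact ⟨z, hz.mem hZ, hexp⟩

/-- The Baker–Campbell–Hausdorff formula in a `p`-adically complete ring. -/
theorem exists_bch (hD : IsPadicComplete p D) {a b s t : D}
    (ha : a ∈ padicSub p (boldExp p) D) (hb : b ∈ padicSub p (boldExp p) D)
    (hs : IsPadicExp p a s) (ht : IsPadicExp p b t) :
    ∃ (z : ℕ → D) (c : D), (∀ n, z n ∈ padicSub p (boldExp p) D) ∧
      (∀ n, (1 : ℚ) ⊗ₜ[ℤ] z n = FreeAlgebra.lift ℚ ![(1 : ℚ) ⊗ₜ[ℤ] a, (1 : ℚ) ⊗ₜ[ℤ] b]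
        (bchComponent n)) ∧
      PadicTendsto p (fun N => ∑ n ∈ Icc 1 N, z n) c ∧ IsPadicExp p c (s * t) := by
  obtain ⟨u, hu, hus⟩ := hs
  obtain ⟨v, hv, hvt⟩ := ht
  have hu0 : u 0 = 1 := by simpa using hu 0
  have hv0 : v 0 = 1 := by simpa using hv 0
  have hmem : ∀ {a : D} {u : ℕ → D}, a ∈ padicSub p (boldExp p) D →
      (∀ n, n.factorial • u n = a ^ n) → u 0 = 1 →
      ∀ n, coeff n (mk u - 1) ∈ padicSub p (boldExp p) D := by
    intro a u ha hu hu0 n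
    rw [map_sub, coeff_mk, coeff_one]
    split_ifs with h
    · simp [h, hu0]
    · rw [sub_zero]
      exact expTerm_mem hD ha (hu n) (factorial_valuation_add_boldExp h)
  set ι : D →+* ℚ ⊗[ℤ] D :=
    (Algebra.TensorProduct.includeRight : D →ₐ[ℤ] ℚ ⊗[ℤ] D).toRingHom with hι
  obtain ⟨Z, z, hZ, hmap, hz, hexp⟩ := exists_log hD ι (injective_includeRight hD)
    (G := mk u * mk v) (g := s * t) (by simp [hu0, hv0]) (by
      intro n
      have : mk u * mk v - 1 = (mk u - 1) * mk v + (mk v - 1) := by noncomm_ring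
      rw [this, map_add]
      refine add_mem ?_ (hmem hb hv hv0 n)
      simpa using coeff_mul_mem_padicSub (hmem ha hu hu0) (fun n => mem_padicSub_zero _) n)
    (HasPadicSum.mul (by simp only [coeff_mk]; exact hus) (by simp only [coeff_mk]; exact hvt))
  have hmk : ∀ {a : D} {u : ℕ → D}, (∀ n, n.factorial • u n = a ^ n) →
      PowerSeries.map ι (mk u) = expSeries (ι a) := by
    intro a u hu
    ext n
    rw [coeff_map, coeff_mk, coeff_expSeries, ← map_pow, ← hu, map_nsmul,
      ← Nat.cast_smul_eq_nsmul ℚ, smul_smul,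
      inv_mul_cancel₀ (by exact_mod_cast n.factorial_ne_zero), one_smul]
  set ψ := FreeAlgebra.lift ℚ ![(1 : ℚ) ⊗ₜ[ℤ] a, (1 : ℚ) ⊗ₜ[ℤ] b] with hψ
  have hexpψ : ∀ x, PowerSeries.map ψ.toRingHom (expSeries x) = expSeries (ψ x) := by
    intro x
    ext n
    rw [coeff_map, coeff_expSeries, coeff_expSeries]
    simp
  -- The variable `T` records the degree, so the coefficient of `T^n` in `log(e^{Ta} e^{Tb})` is the
  -- value of the `n`-th homogeneous component.
  have hterm : ∀ n, (1 : ℚ) ⊗ₜ[ℤ] coeff n Z = ψ (bchComponent n) := by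
    intro n
    have h1 : (1 : ℚ) ⊗ₜ[ℤ] coeff n Z = coeff n (PowerSeries.map ι Z) := by
      rw [coeff_map]
      rfl
    have h2 : PowerSeries.map ι (mk u * mk v - 1) = PowerSeries.map ψ.toRingHom
        (expSeries (FreeAlgebra.ι ℚ (0 : Fin 2)) * expSeries (FreeAlgebra.ι ℚ (1 : Fin 2)) - 1) := by
      rw [map_sub, map_sub, map_mul, map_mul, map_one, map_one, hmk hu, hmk hv, hexpψ, hexpψ]
      simp [hψ, hι]
    rw [h1, hmap, h2, seriesComp, coeff_mk, sum_range_succ', coeff_log, if_pos rfl, zero_smul,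
      add_zero, bchComponent, map_sum, sum_Icc_one_eq_sum_range]
    refine sum_congr rfl fun k _ => ?_
    rw [coeff_log, if_neg k.succ_ne_zero, map_smul, ← map_pow, coeff_map]
    rfl
  refine ⟨fun n => coeff n Z, z, hZ, hterm, ?_, hexp⟩
  have hZ0 : coeff 0 Z = 0 := by
    apply injective_includeRight hD
    change (1 : ℚ) ⊗ₜ[ℤ] coeff 0 Z = (1 : ℚ) ⊗ₜ[ℤ] 0
    rw [hterm, bchComponent]
    simp
  refine padicTendsto_iff.mpr fun k => ?_
  obtain ⟨N, hN⟩ := padicTendsto_iff.mp hz k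
  refine ⟨N, fun n hn => ?_⟩
  have := hN (n + 1) (by omega)
  rwa [sum_range_succ', hZ0, add_zero, show ∑ k ∈ range n, coeff (k + 1) Z
    = ∑ k ∈ Icc 1 n, coeff k Z from (sum_Icc_one_eq_sum_range (fun k => coeff k Z) n).symm] at this

section FreeLie

attribute [local instance] LieRing.ofAssociativeRing

/-- The components of the Baker–Campbell–Hausdorff series are Lie polynomials. -/
theorem exists_freeLieToAssoc_eq_bchComponent (n : ℕ) :
    ∃ h, freeLieToAssoc h = bchComponent n := by
  set x := FreeAlgebra.ι ℚ (0 : Fin 2)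
  set y := FreeAlgebra.ι ℚ (1 : Fin 2)
  set U := expSeries x * expSeries y - 1 with hU
  have hU0 : constantCoeff U = 0 := by
    rw [hU, map_sub, map_mul, ← coeff_zero_eq_constantCoeff_apply,
      ← coeff_zero_eq_constantCoeff_apply, coeff_expSeries, coeff_expSeries]
    simp
  have hcomp : bchComponent n = coeff n (seriesComp (log ℚ) U) := by
    rw [seriesComp, coeff_mk, sum_range_succ', coeff_log, if_pos rfl, zero_smul,
      add_zero, bchComponent, sum_Icc_one_eq_sum_range]
    refine sum_congr rfl fun k _ => ?_
    rw [coeff_log, if_neg k.succ_ne_zero]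
    rfl
  let V : Submodule ℚ (FreeAlgebra ℚ (Fin 2)) :=
    LinearMap.range (freeLieToAssoc : FreeLieAlgebra ℚ (Fin 2) →ₗ[ℚ] FreeAlgebra ℚ (Fin 2))
  have hmem : bchComponent n ∈ V := by
    rw [hcomp]
    refine coeff_mem_of_exp_eq V ?_ (x := x) (y := y) ?_ ?_ (constantCoeff_seriesComp
      constantCoeff_log) (fun m => ?_) n
    · rintro _ ⟨u, rfl⟩ _ ⟨v, rfl⟩
      refine ⟨⁅u, v⁆, ?_⟩
      exact LieHom.map_lie freeLieToAssoc u v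
    · exact ⟨FreeLieAlgebra.of ℚ 0, FreeLieAlgebra.lift_of_apply _ _⟩
    · exact ⟨FreeLieAlgebra.of ℚ 1, FreeLieAlgebra.lift_of_apply _ _⟩
    · rw [sum_coeff_seriesComp_log_pow hU0, hU, add_sub_cancel]
  exact hmem

end FreeLie

end PadicExp

/-! ### `p`-adic completeness of power series rings and their endomorphisms -/

section Completeness

variable {p : ℕ} {M : Type*} [AddCommGroup M]

theorem PadicTendsto.add {u v : ℕ → M} {c d : M} (hu : PadicTendsto p u c)
    (hv : PadicTendsto p v d) : PadicTendsto p (fun n => u n + v n) (c + d) := by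
  simpa using hu.sub (hv.map (-AddMonoidHom.id M))

theorem sub_mem_padicSub_of_le {u : ℕ → M} {k N : ℕ}
    (hu : ∀ n, N ≤ n → u (n + 1) - u n ∈ padicSub p k M) {n : ℕ} (hn : N ≤ n) (m : ℕ) :
    u (n + m) - u n ∈ padicSub p k M := by
  induction m with
  | zero => simp
  | succ m ih =>
    have := add_mem (hu (n + m) (by omega)) ih
    rwa [sub_add_sub_cancel] at this

/-- The limit is reached modulo `p ^ k` from the same index at which the sequence becomes constant
modulo `p ^ k`. This uniformity turns coordinatewise or pointwise limits into limits in products and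
endomorphism rings. -/
theorem PadicTendsto.sub_mem_of_le {u : ℕ → M} {c : M} (h : PadicTendsto p u c) {k N : ℕ}
    (hu : ∀ n, N ≤ n → u (n + 1) - u n ∈ padicSub p k M) {n : ℕ} (hn : N ≤ n) :
    u n - c ∈ padicSub p k M := by
  obtain ⟨N', hN'⟩ := padicTendsto_iff.mp h k
  have h1 := sub_mem_padicSub_of_le hu hn N'
  have h2 := sub_mem (hN' (n + N') (by omega)) h1
  rwa [sub_sub_sub_cancel_left] at h2

theorem mem_padicSub_pi {ι : Type*} {k : ℕ} {f : ι → M} :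
    f ∈ padicSub p k (ι → M) ↔ ∀ i, f i ∈ padicSub p k M := by
  constructor
  · intro h i
    exact map_mem_padicSub (Pi.evalAddMonoidHom _ i) h
  · intro h
    choose g hg using h
    exact ⟨g, funext hg⟩

theorem IsPadicComplete.pi (ι : Type*) (hM : IsPadicComplete p M) :
    IsPadicComplete p (ι → M) where
  torsionFree n hn x hx := funext fun i => hM.torsionFree n hn _ (congrFun hx i)
  separated x hx := funext fun i => hM.separated _ fun k => mem_padicSub_pi.mp (hx k) i
  complete u hu := by
    choose N hN using hu
    choose c hc using fun i => hM.complete (fun n => u n i) fun k =>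
      ⟨N k, fun n hn => mem_padicSub_pi.mp (hN k n hn) i⟩
    refine ⟨c, padicTendsto_iff.mpr fun k => ⟨N k, fun n hn => mem_padicSub_pi.mpr fun i => ?_⟩⟩
    exact (hc i).sub_mem_of_le (fun n hn => mem_padicSub_pi.mp (hN k n hn) i) hn
  divisible n hn x := by
    choose y hy using fun i => hM.divisible n hn (x i)
    exact ⟨y, funext hy⟩

theorem IsPadicComplete.mvPowerSeries (σ : Type*) {R : Type*} [CommRing R]
    (hR : IsPadicComplete p R) : IsPadicComplete p (MvPowerSeries σ R) :=
  hR.pi (σ →₀ ℕ)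

variable {R : Type*} [CommRing R] [Module R M]

/-- Quotients by `n` are unique in a torsion-free module, so dividing the values pointwise gives a
linear map. -/
theorem IsPadicComplete.exists_end_smul_eq (hM : IsPadicComplete p M) {n : ℕ} (hn : n ≠ 0)
    {f : Module.End R M} (hf : ∀ x, ∃ y, n • y = f x) : ∃ g : Module.End R M, n • g = f := by
  choose g hg using hf
  refine ⟨⟨⟨g, fun x y => hM.smul_cancel hn ?_⟩, fun r x => hM.smul_cancel hn ?_⟩,
    LinearMap.ext hg⟩
  · rw [smul_add, hg, hg, hg, map_add]
  · rw [hg, map_smul, RingHom.id_apply, smul_comm, hg]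

variable [hp : Fact p.Prime]

theorem mem_padicSub_end (hM : IsPadicComplete p M) {k : ℕ} {f : Module.End R M} :
    f ∈ padicSub p k (Module.End R M) ↔ ∀ x, f x ∈ padicSub p k M :=
  ⟨fun h x => map_mem_padicSub (LinearMap.applyₗ' R x).toAddMonoidHom h,
    hM.exists_end_smul_eq (pow_ne_zero k hp.out.ne_zero)⟩

theorem IsPadicComplete.moduleEnd (hM : IsPadicComplete p M) :
    IsPadicComplete p (Module.End R M) where
  torsionFree n hn f hf := LinearMap.ext fun x => hM.torsionFree n hn _ (LinearMap.congr_fun hf x)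
  separated f hf := LinearMap.ext fun x =>
    hM.separated _ fun k => (mem_padicSub_end hM).mp (hf k) x
  complete u hu := by
    choose N hN using hu
    have hN' : ∀ x k n, N k ≤ n → u (n + 1) x - u n x ∈ padicSub p k M :=
      fun x k n hn => (mem_padicSub_end hM).mp (hN k n hn) x
    choose c hc using fun x => hM.complete (fun n => u n x) fun k => ⟨N k, hN' x k⟩
    refine ⟨⟨⟨c, fun x y => ?_⟩, fun r x => ?_⟩, padicTendsto_iff.mpr fun k =>
      ⟨N k, fun n hn => (mem_padicSub_end hM).mpr fun x => (hc x).sub_mem_of_le (hN' x k) hn⟩⟩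
    · refine hM.tendsto_unique (hc (x + y)) ?_
      simpa only [map_add] using (hc x).add (hc y)
    · refine hM.tendsto_unique (hc (r • x)) ?_
      simp only [map_smul]
      exact (hc x).map (DistribSMul.toAddMonoidHom M r)
  divisible n hn f := by
    refine hM.exists_end_smul_eq (fun h => hn (by simp [h])) fun x => ?_
    exact hM.divisible n hn (f x)

end Completeness

/-! ### Pro-`p` domains of characteristic `0` are `p`-adically complete -/

section Base

theorem isClosed_padicSub {R : Type*} [CommRing R] [TopologicalSpace R] [IsTopologicalRing R]
    [CompactSpace R] [T2Space R] (p k : ℕ) : IsClosed (padicSub p k R : Set R) := by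
  have h : (padicSub p k R : Set R) = Set.range fun x : R => p ^ k • x := rfl
  rw [h]
  exact (isCompact_range (continuous_const_smul _)).isClosed

variable {p : ℕ} {R : Type*} [CommRing R] [IsLocalRing R]
  [UniformSpace R] [IsTopologicalRing R] [IsLinearTopology R R] [T2Space R]

/-- For a proper open ideal `I`, the order `p ^ k` of `R ⧸ I` annihilates `1`, so `p ^ k ∈ I`. -/
theorem natCast_mem_maximalIdeal (hR : IsProP p R) :
    (p : R) ∈ IsLocalRing.maximalIdeal R := by
  obtain ⟨I, hI, hsub⟩ := (IsLinearTopology.hasBasis_open_ideal (R := R)).mem_iff.mp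
    (isOpen_compl_singleton.mem_nhds (show (0 : R) ∈ ({1}ᶜ : Set R) by simp))
  have hne : I ≠ ⊤ := by
    rw [Ideal.ne_top_iff_one]
    intro h
    exact hsub h rfl
  obtain ⟨k, hk⟩ := hR I hI
  have hmem : (p : R) ^ k ∈ I := by
    rw [← Ideal.Quotient.eq_zero_iff_mem, map_pow, map_natCast, ← Nat.cast_pow, ← hk,
      ← nsmul_one]
    exact card_nsmul_eq_zero'
  exact (IsLocalRing.maximalIdeal.isMaximal R).isPrime.mem_of_pow_mem k
    (IsLocalRing.le_maximalIdeal hne hmem)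

variable [hp : Fact p.Prime]

theorem isUnit_natCast_of_not_dvd (hR : IsProP p R) {n : ℕ} (hn : ¬ p ∣ n) :
    IsUnit (n : R) := by
  by_contra h
  have h1 := (IsLocalRing.mem_maximalIdeal _).mpr h
  have h2 := natCast_mem_maximalIdeal hR
  obtain ⟨a, b, hab⟩ := Int.isCoprime_iff_gcd_eq_one.mpr
    (show Int.gcd (n : ℤ) (p : ℤ) = 1 from
      ((Nat.Prime.coprime_iff_not_dvd hp.out).mpr hn).symm)
  have h3 : ((a : R) * n + (b : R) * p) = 1 := by exact_mod_cast congrArg (Int.cast (R := R)) hab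
  refine (Ideal.ne_top_iff_one _).mp (IsLocalRing.maximalIdeal.isMaximal R).ne_top ?_
  rw [← h3]
  exact add_mem (Ideal.mul_mem_left _ _ h1) (Ideal.mul_mem_left _ _ h2)

/-- Separatedness is Krull's intersection theorem, as `p` lies in the maximal ideal. For
completeness, a cluster point exists by compactness, and it is a `p`-adic limit because each `p ^ k
R` is closed, being a continuous image of a compact space. -/
theorem isPadicComplete_of_isProP [CompactSpace R] [IsDomain R] [CharZero R] [IsNoetherianRing R]
    (hR : IsProP p R) : IsPadicComplete p R where
  torsionFree n hn x hx := by
    rw [nsmul_eq_mul, mul_eq_zero] at hx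
    exact hx.resolve_left (by exact_mod_cast hn)
  separated x hx := by
    have h : x ∈ (⨅ k, IsLocalRing.maximalIdeal R ^ k : Ideal R) := by
      rw [Ideal.mem_iInf]
      intro k
      obtain ⟨w, rfl⟩ := hx k
      rw [nsmulAddMonoidHom_apply, nsmul_eq_mul, Nat.cast_pow]
      exact Ideal.mul_mem_right _ _ (Ideal.pow_mem_pow (natCast_mem_maximalIdeal hR) k)
    rwa [Ideal.iInf_pow_eq_bot_of_isLocalRing _ (IsLocalRing.maximalIdeal.isMaximal R).ne_top]
      at h
  complete u hu := by
    obtain ⟨c, hc⟩ := exists_clusterPt_of_compactSpace (Filter.map u Filter.atTop)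
    refine ⟨c, padicTendsto_iff.mpr fun k => ?_⟩
    obtain ⟨N, hN⟩ := hu k
    have h1 : IsClosed {x : R | x - u N ∈ padicSub p k R} :=
      (isClosed_padicSub p k).preimage (continuous_id.sub continuous_const)
    have h2 : c - u N ∈ padicSub p k R := by
      refine h1.mem_of_mapClusterPt hc ?_
      filter_upwards [Filter.eventually_ge_atTop N] with n hn
      obtain ⟨m, rfl⟩ := Nat.exists_eq_add_of_le hn
      exact sub_mem_padicSub_of_le hN le_rfl m
    refine ⟨N, fun n hn => ?_⟩
    obtain ⟨m, rfl⟩ := Nat.exists_eq_add_of_le hn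
    have h3 := sub_mem (sub_mem_padicSub_of_le hN le_rfl m) h2
    rwa [sub_sub_sub_cancel_right] at h3
  divisible n hn x := by
    obtain ⟨v, hv⟩ := isUnit_natCast_of_not_dvd hR hn
    exact ⟨(v⁻¹ : Rˣ) * x, by rw [nsmul_eq_mul, ← hv, Units.mul_inv_cancel_left]⟩

end Base

/-! ### Evaluation of power series -/

theorem isClosed_span_singleton {S : Type*} [CommRing S] [TopologicalSpace S]
    [IsTopologicalRing S] [CompactSpace S] [T2Space S] (r : S) :
    IsClosed ((Ideal.span {r} : Ideal S) : Set S) := by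
  have h : ((Ideal.span {r} : Ideal S) : Set S) = Set.range fun x => x * r := by
    ext x
    simp [Ideal.mem_span_singleton', eq_comm]
  rw [h]
  exact (isCompact_range (continuous_id.mul continuous_const)).isClosed

theorem mem_span_boldP_iff {p : ℕ} {S : Type*} [CommRing S] {x : S} :
    x ∈ Ideal.span {(boldP p : S)} ↔ x ∈ padicSub p (boldExp p) S := by
  rw [Ideal.mem_span_singleton', mem_padicSub, pow_boldExp]
  simp only [nsmul_eq_mul, mul_comm]

/-- Variables are removed one at a time: a series is the sum of a multiple of `X i` and a series in
which `X i` does not occur. -/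
theorem MvPowerSeries.mem_span_X_image {σ R : Type*} [CommRing R] (s : Finset σ) :
    ∀ f : MvPowerSeries σ R, (∀ e : σ →₀ ℕ, (∀ i ∈ s, e i = 0) → coeff e f = 0) →
      f ∈ Ideal.span ((X : σ → MvPowerSeries σ R) '' s) := by
  classical
  induction s using Finset.induction_on with
  | empty =>
    intro f hf
    have : f = 0 := by
      ext e
      simpa using hf e
    simp [this]
  | insert i s hi ih =>
    intro f hf
    let g : MvPowerSeries σ R := fun e => if e i = 0 then 0 else coeff e f
    let h : MvPowerSeries σ R := fun e => if e i = 0 then coeff e f else 0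
    have hg : ∀ e, coeff e g = if e i = 0 then 0 else coeff e f := fun e => rfl
    have hh : ∀ e, coeff e h = if e i = 0 then coeff e f else 0 := fun e => rfl
    have hfgh : f = g + h := by
      ext e
      rw [map_add, hg, hh]
      split_ifs <;> simp
    rw [hfgh]
    refine add_mem ?_ (Ideal.span_mono (Set.image_mono (by simp)) (ih h fun e he => ?_))
    · refine Ideal.mem_of_dvd _ (X_dvd_iff.mpr fun e he => by rw [hg, if_pos he])
        (Ideal.subset_span ⟨i, by simp, rfl⟩)
    · rw [hh]
      split_ifs with h0
      · exact hf e fun j hj => by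
          rcases Finset.mem_insert.mp hj with rfl | hj
          · exact h0
          · exact he j hj
      · rfl

theorem MvPowerSeries.exists_eq_C_add_sum {d : ℕ} {R : Type*} [CommRing R]
    (f : MvPowerSeries (Fin d) R) : ∃ c : Fin d → MvPowerSeries (Fin d) R,
      f = C (constantCoeff f) + ∑ i, c i * X i := by
  have h : f - C (constantCoeff f) ∈ Ideal.span (Set.range (X : Fin d → MvPowerSeries (Fin d) R)) := by
    have := mem_span_X_image Finset.univ (f - C (constantCoeff f)) (fun e he => by
      obtain rfl : e = 0 := Finsupp.ext fun i => he i (Finset.mem_univ i)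
      simp)
    simpa using this
  obtain ⟨c, hc⟩ := (Ideal.mem_span_range_iff_exists_fun).mp h
  exact ⟨c, by rw [hc, add_sub_cancel]⟩

/-- Two `R`-algebra homomorphisms `R[[X_1, …, X_d]] → R` with the same values in the maximal ideal
on the variables coincide. -/
theorem algHom_eq_of_apply_X_eq {R : Type*} [CommRing R] [IsLocalRing R] [IsNoetherianRing R]
    {d : ℕ} {φ ψ : MvPowerSeries (Fin d) R →ₐ[R] R}
    (h : ∀ i, φ (MvPowerSeries.X i) = ψ (MvPowerSeries.X i))
    (hm : ∀ i, ψ (MvPowerSeries.X i) ∈ IsLocalRing.maximalIdeal R) : φ = ψ := by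
  have hC : ∀ (χ : MvPowerSeries (Fin d) R →ₐ[R] R) (r : R), χ (MvPowerSeries.C r) = r :=
    fun χ r => χ.commutes r
  -- No continuity is assumed. Writing `f = f(0) + ∑ c i * X i`, a congruence modulo the `k`-th
  -- power of the maximal ideal for the `c i` gains one more factor from the common value on `X i`;
  -- Krull's theorem then finishes.
  have key : ∀ k, ∀ f, φ f - ψ f ∈ IsLocalRing.maximalIdeal R ^ k := by
    intro k
    induction k with
    | zero => simp
    | succ k ih =>
      intro f
      obtain ⟨c, hc⟩ := MvPowerSeries.exists_eq_C_add_sum f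
      rw [hc, map_add, map_add, hC, hC, add_sub_add_left_eq_sub, map_sum, map_sum,
        ← Finset.sum_sub_distrib]
      refine Ideal.sum_mem _ fun i _ => ?_
      rw [map_mul, map_mul, h, ← sub_mul, pow_succ]
      exact Ideal.mul_mem_mul (ih _) (hm i)
  ext f
  rw [← sub_eq_zero, ← Ideal.mem_bot, ← Ideal.iInf_pow_eq_bot_of_isLocalRing _
    (IsLocalRing.maximalIdeal.isMaximal R).ne_top, Ideal.mem_iInf]
  exact fun k => key k f

theorem infinite_maximalIdeal {p : ℕ} [hp : Fact p.Prime] {R : Type*} [CommRing R] [IsDomain R]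
    [CharZero R] [IsLocalRing R] [UniformSpace R] [IsTopologicalRing R] [IsLinearTopology R R]
    [T2Space R] (hR : IsProP p R) :
    ((IsLocalRing.maximalIdeal R : Ideal R) : Set R).Infinite := by
  refine Set.infinite_of_injective_forall_mem (f := fun n : ℕ => (n : R) * p) ?_ fun n =>
    Ideal.mul_mem_left _ _ (natCast_mem_maximalIdeal hR)
  intro m n h
  exact_mod_cast mul_right_cancel₀ (show (p : R) ≠ 0 by exact_mod_cast hp.out.ne_zero) h

section Evaluation

theorem HasSum.mem_ideal {S : Type*} [CommRing S] [TopologicalSpace S] {J : Ideal S}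
    (hJ : IsClosed (J : Set S)) {α : Type*} {f : α → S} {s : S} (h : HasSum f s)
    (hf : ∀ i, f i ∈ J) : s ∈ J :=
  hJ.mem_of_tendsto h (Filter.Eventually.of_forall fun _ => Ideal.sum_mem _ fun i _ => hf i)

theorem aeval_sub_aeval_mem {R σ S : Type*} [CommRing R] [UniformSpace R] [IsUniformAddGroup R]
    [IsTopologicalSemiring R] [CommRing S] [UniformSpace S] [IsUniformAddGroup S] [CompleteSpace S]
    [T2Space S] [IsTopologicalRing S] [IsLinearTopology S S] [Algebra R S] [ContinuousSMul R S]
    {J : Ideal S} (hJ : IsClosed (J : Set S)) {a b : σ → S} (ha : MvPowerSeries.HasEval a)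
    (hb : MvPowerSeries.HasEval b) (hab : ∀ i, a i - b i ∈ J) (f : MvPowerSeries σ R) :
    MvPowerSeries.aeval ha f - MvPowerSeries.aeval hb f ∈ J := by
  refine ((MvPowerSeries.hasSum_aeval ha f).sub (MvPowerSeries.hasSum_aeval hb f)).mem_ideal hJ
    fun e => ?_
  rw [← smul_sub]
  have h : (e.prod fun s n => a s ^ n) - (e.prod fun s n => b s ^ n) ∈ J := by
    rw [← Ideal.Quotient.eq, Finsupp.prod, Finsupp.prod, map_prod, map_prod]
    refine Finset.prod_congr rfl fun i _ => ?_
    rw [map_pow, map_pow, Ideal.Quotient.eq.mpr (hab i)]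
  rw [Algebra.smul_def]
  exact Ideal.mul_mem_left _ _ h

variable {R : Type*} [CommRing R] [IsLocalRing R] [UniformSpace R] [IsUniformAddGroup R]
  [IsTopologicalRing R] [IsLinearTopology R R] [CompactSpace R] [T2Space R]

/-- The axioms of a formal group law use algebraic substitution, the translations use the
topological one. The two agree coefficientwise, since each coefficient of the substituted series is
a finite sum. -/
theorem subst_eq_substAt {ι κ : Type*} [Finite ι] (g : ι → MvPowerSeries κ R)
    (hg : ∀ i, MvPowerSeries.constantCoeff (g i) = 0) (f : MvPowerSeries ι R) :
    MvPowerSeries.subst g f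
      = substAt g (fun i => by rw [hg i]; exact Ideal.zero_mem _) f := by
  have hs := MvPowerSeries.hasSubst_of_constantCoeff_zero hg
  ext e
  rw [MvPowerSeries.coeff_subst hs]
  have h1 := MvPowerSeries.hasSum_aeval (hasEval_of_constantCoeff_mem (g := g)
    (fun i => by rw [hg i]; exact Ideal.zero_mem _)) f
  have h2 := h1.map (MvPowerSeries.coeff (R := R) e)
    (MvPowerSeries.WithPiTopology.continuous_coeff R e)
  have h3 := MvPowerSeries.coeff_subst_finite hs f e
  refine HasSum.unique ?_ h2
  have h4 : HasSum (fun d => MvPowerSeries.coeff d f •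
      MvPowerSeries.coeff e (d.prod fun s n => g s ^ n)) _ :=
    hasSum_sum_of_ne_finset_zero (s := Set.Finite.toFinset h3) (fun d hd => by
      simpa using hd)
  rw [finsum_eq_sum _ h3]
  simpa only [Function.comp_def, map_smul] using h4

theorem evalAt_sub_evalAt_mem {ι : Type*} [Finite ι] {J : Ideal R} (hJ : IsClosed (J : Set R))
    {x y : ι → IsLocalRing.maximalIdeal R} (h : ∀ i, (x i : R) - y i ∈ J)
    (f : MvPowerSeries ι R) : evalAt x f - evalAt y f ∈ J :=
  aeval_sub_aeval_mem hJ _ _ h f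

variable {p : ℕ} [hp : Fact p.Prime] [IsDomain R] [CharZero R] [IsNoetherianRing R]

/-- A power series that vanishes at all points with coordinates in the maximal ideal is `0`. -/
theorem eq_zero_of_evalAt_eq_zero (hR : IsProP p R) {d : ℕ} {f : MvPowerSeries (Fin d) R}
    (hf : ∀ x, evalAt x f = 0) : f = 0 := by
  have hpR := isPadicComplete_of_isProP hR
  have key : ∀ k, ∀ e : Fin d →₀ ℕ, e.degree < k → MvPowerSeries.coeff e f = 0 := by
    intro k
    induction k with
    | zero => simp
    | succ k ih =>
      -- By induction `P` is homogeneous of degree `k`. A polynomial over a domain that vanishes on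
      -- the infinite set of points over the maximal ideal is `0`.
      set P := MvPowerSeries.truncTotal (k + 1) f with hP
      have hPcoeff : ∀ e : Fin d →₀ ℕ, MvPowerSeries.coeff e (P : MvPowerSeries (Fin d) R)
          = if e.degree < k + 1 then MvPowerSeries.coeff e f else 0 := by
        intro e
        rw [MvPolynomial.coeff_coe, hP]
        split_ifs with h
        · exact MvPowerSeries.coeff_truncTotal _ h
        · exact MvPowerSeries.coeff_truncTotal_eq_zero _ (not_lt.mp h)
      have hP0 : P = 0 := by
        refine MvPolynomial.funext_set (fun _ => (IsLocalRing.maximalIdeal R : Set R))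
          (fun _ => infinite_maximalIdeal hR) fun y hy => ?_
        rw [map_zero]
        let y' : Fin d → IsLocalRing.maximalIdeal R := fun i => ⟨y i, hy i (Set.mem_univ i)⟩
        have hy' : evalAt y' (P : MvPowerSeries (Fin d) R) = MvPolynomial.eval y P := by
          unfold evalAt
          rw [MvPowerSeries.aeval_coe, MvPolynomial.aeval_eq_eval]
        rw [← hy']
        refine hpR.separated _ fun n => ?_
        -- Scaling the point isolates the leading form: `f(p^n y) ≡ p^{nk} P(y)` modulo
        -- `p^{n(k+1)}`. As `f(p^n y) = 0`, the value `P(y)` is divisible by `p^n` for every `n`.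
        let z : Fin d → IsLocalRing.maximalIdeal R := fun i =>
          ⟨(p : R) ^ n * y i, Ideal.mul_mem_left _ _ (hy i (Set.mem_univ i))⟩
        have h1 := MvPowerSeries.hasSum_aeval (hasEval_of_mem_maximalIdeal
          (x := fun i => (z i : R)) fun i => (z i).2) f
        have h2 := (MvPowerSeries.hasSum_aeval (hasEval_of_mem_maximalIdeal
          (x := fun i => (y' i : R)) fun i => (y' i).2) (P : MvPowerSeries (Fin d) R)).mul_left
            ((p : R) ^ (n * k))
        have hz : ∀ e : Fin d →₀ ℕ, (e.prod fun s m => (z s : R) ^ m)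
            = (p : R) ^ (n * e.degree) * e.prod fun s m => (y' s : R) ^ m := by
          intro e
          simp only [z, y', Finsupp.prod, mul_pow, Finset.prod_mul_distrib, ← pow_mul,
            Finset.prod_pow_eq_pow_sum, Finsupp.degree_apply, Finset.mul_sum]
        have h3 := (h1.sub h2).mem_ideal (isClosed_span_singleton ((p : R) ^ (n * (k + 1))))
          fun e => by
            rw [hz, hPcoeff, Ideal.mem_span_singleton]
            rcases lt_trichotomy e.degree k with h | h | h
            · rw [ih e h]
              simp
            · rw [if_pos (by omega), h, smul_eq_mul, smul_eq_mul, mul_left_comm, sub_self]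
              exact dvd_zero _
            · rw [if_neg (by omega), zero_smul, mul_zero, sub_zero, smul_eq_mul, mul_left_comm]
              exact Dvd.dvd.mul_right (pow_dvd_pow _ (Nat.mul_le_mul_left n h)) _
        change evalAt z f - (p : R) ^ (n * k) * evalAt y' (P : MvPowerSeries (Fin d) R) ∈ _ at h3
        rw [hf z, zero_sub, neg_mem_iff, Ideal.mem_span_singleton, mul_add, mul_one,
          pow_add] at h3
        obtain ⟨w, hw⟩ := (mul_dvd_mul_iff_left (pow_ne_zero _
          (show (p : R) ≠ 0 by exact_mod_cast hp.out.ne_zero))).mp h3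
        exact ⟨w, by rw [hw]; simp⟩
      intro e he
      have := hPcoeff e
      rw [if_pos he, hP0] at this
      simpa using this.symm
  ext e
  simpa using key _ e (Nat.lt_succ_self _)

end Evaluation

/-! ### Translations on a standard group -/

namespace StandardGroup

variable {R : Type*} [CommRing R] [IsLocalRing R] [UniformSpace R] [IsUniformAddGroup R]
  [IsTopologicalRing R] [IsLinearTopology R R] [CompactSpace R] [T2Space R]
  {d : ℕ} {G : Type*} [Group G] (S : StandardGroup R d G)

theorem evalAt_law_zero_left (y : Fin d → IsLocalRing.maximalIdeal R) (i : Fin d) :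
    evalAt (Sum.elim (fun _ => 0) y) (S.law.toSeries i) = y i := by
  have h := S.law.left_unit i
  rw [subst_eq_substAt _ (by rintro (j | j) <;> simp)] at h
  have h2 := congrArg (evalAt y) h
  rw [evalAt_X] at h2
  rw [← h2]
  refine (evalAt_substAt _ _ _ _ ?_ _).symm
  rintro (j | j)
  · simp
  · simp [evalAt_X]

/-- By `F(0, Y) = Y` the origin is idempotent, and the only idempotent of a group is `1`. -/
theorem coord_one : S.coord 1 = fun _ => 0 := by
  have h : S.coord.symm (fun _ => 0) * S.coord.symm (fun _ => 0) = S.coord.symm fun _ => 0 := by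
    apply S.coord.injective
    ext i
    rw [S.coord_mul]
    simp only [Equiv.apply_symm_apply]
    exact S.evalAt_law_zero_left _ i
  rw [← mul_eq_left.mp h, Equiv.apply_symm_apply]

/-- If `x ≡ 0` modulo `I`, then `F(x, y) ≡ F(0, y) = y`. Applied to `y = x⁻¹`, this also gives the
closure of `G(I)` under inverses. -/
theorem coord_mul_sub_mem {I : Ideal R} (hI : IsClosed (I : Set R)) {x : G}
    (hx : x ∈ S.points I) (y : G) (i : Fin d) :
    (S.coord (x * y) i : R) - S.coord y i ∈ I := by
  rw [S.coord_mul, ← S.evalAt_law_zero_left (S.coord y) i]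
  refine evalAt_sub_evalAt_mem hI ?_ _
  rintro (j | j)
  · simpa using hx j
  · simp

/-- The subgroup `G(I)` of `G`. -/
def pointsSubgroup {I : Ideal R} (hI : IsClosed (I : Set R)) : Subgroup G where
  carrier := S.points I
  one_mem' i := by simp [coord_one]
  mul_mem' {x y} hx hy i := by
    have := add_mem (S.coord_mul_sub_mem hI hx y i) (hy i)
    rwa [sub_add_cancel] at this
  inv_mem' {x} hx i := by
    have := S.coord_mul_sub_mem hI hx x⁻¹ i
    rw [mul_inv_cancel, coord_one] at this
    simpa using this

instance compactSpace_mvPowerSeries {σ : Type*} : CompactSpace (MvPowerSeries σ R) :=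
  inferInstanceAs (CompactSpace ((σ →₀ ℕ) → R))

/-- Modulo `𝐩` the substituted series `F(X, x)` is `F(X, 0) = X`; the congruence passes to `f`
because the ideal generated by `𝐩` is closed in the compact ring `A`. -/
theorem rightTranslation_sub_mem {p : ℕ} {x : G}
    (hx : x ∈ S.points (Ideal.span {(boldP p : R)})) (f : MvPowerSeries (Fin d) R) :
    S.rightTranslation x f - f ∈ Ideal.span {(boldP p : MvPowerSeries (Fin d) R)} := by
  have hclosed := isClosed_span_singleton (boldP p : MvPowerSeries (Fin d) R)
  have hX : substAt (MvPowerSeries.X : Fin d → MvPowerSeries (Fin d) R) (by simp) f = f := by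
    rw [← subst_eq_substAt _ (by simp), MvPowerSeries.subst_self]
    rfl
  have key : ∀ i, S.rightMul x i - MvPowerSeries.X i
      ∈ Ideal.span {(boldP p : MvPowerSeries (Fin d) R)} := by
    intro i
    have h := S.law.right_unit i
    rw [subst_eq_substAt _ (by rintro (j | j) <;> simp)] at h
    rw [← h]
    refine aeval_sub_aeval_mem hclosed _ _ ?_ _
    rintro (j | j)
    · simp
    · obtain ⟨r, hr⟩ := Ideal.mem_span_singleton'.mp (hx j)
      refine Ideal.mem_span_singleton'.mpr ⟨MvPowerSeries.C r, ?_⟩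
      rw [Sum.elim_inr, Sum.elim_inr, sub_zero, ← hr, map_mul, map_natCast]
  nth_rewrite 2 [← hX]
  exact aeval_sub_aeval_mem hclosed _ _ key f

theorem rightTranslation_injective {x y : G}
    (h : S.rightTranslation x = S.rightTranslation y) : x = y := by
  apply S.coord.injective
  ext i
  have h1 := congrArg (evalAt (S.coord 1)) (DFunLike.congr_fun h (MvPowerSeries.X i))
  simpa [evalAt_rightTranslation, evalAt_X] using h1

variable {p : ℕ} [hp : Fact p.Prime] [IsDomain R] [CharZero R] [IsNoetherianRing R]

/-- This makes `A` a ring of functions on `G`, so that identities between translations follow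
pointwise from associativity in `G`. -/
theorem ext_of_evalAt (hR : IsProP p R) {f g : MvPowerSeries (Fin d) R}
    (h : ∀ y : G, evalAt (S.coord y) f = evalAt (S.coord y) g) : f = g := by
  rw [← sub_eq_zero]
  refine eq_zero_of_evalAt_eq_zero hR fun x => ?_
  have := h (S.coord.symm x)
  rw [Equiv.apply_symm_apply] at this
  rw [map_sub, this, sub_self]

theorem rightTranslation_mul (hR : IsProP p R) (x y : G) (f : MvPowerSeries (Fin d) R) :
    S.rightTranslation (x * y) f = S.rightTranslation x (S.rightTranslation y f) :=
  S.ext_of_evalAt hR fun z => by simp only [evalAt_rightTranslation, mul_assoc]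

theorem rightTranslation_one (hR : IsProP p R) (f : MvPowerSeries (Fin d) R) :
    S.rightTranslation 1 f = f :=
  S.ext_of_evalAt hR fun z => by simp only [evalAt_rightTranslation, mul_one]

theorem rightTranslation_pow (hR : IsProP p R) (x : G) (n : ℕ) :
    (S.rightTranslation (x ^ n)).toLinearMap = (S.rightTranslation x).toLinearMap ^ n := by
  induction n with
  | zero =>
    ext1 f
    simpa using S.rightTranslation_one hR f
  | succ n ih =>
    rw [pow_succ (S.rightTranslation x).toLinearMap, ← ih]
    ext1 f
    simpa [pow_succ] using S.rightTranslation_mul hR (x ^ n) x f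

theorem rightTranslation_leftTranslation (hR : IsProP p R) (x y : G)
    (f : MvPowerSeries (Fin d) R) :
    S.rightTranslation x (S.leftTranslation y f) = S.leftTranslation y (S.rightTranslation x f) :=
  S.ext_of_evalAt hR fun z => by
    simp only [evalAt_rightTranslation, evalAt_leftTranslation, mul_assoc]

/-- An `R`-algebra endomorphism of `A` that commutes with the left translations and is the identity
modulo `𝐩` is a right translation. -/
theorem exists_rightTranslation_eq (hR : IsProP p R) {I : Ideal R}
    (hI : I ≤ IsLocalRing.maximalIdeal R)
    (φ : MvPowerSeries (Fin d) R →ₐ[R] MvPowerSeries (Fin d) R)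
    (hφ : ∀ (x : G) f, φ (S.leftTranslation x f) = S.leftTranslation x (φ f))
    (hφI : ∀ i, evalAt (S.coord 1) (φ (MvPowerSeries.X i)) ∈ I) :
    ∃ x ∈ S.points I, S.rightTranslation x = φ := by
  set c : Fin d → IsLocalRing.maximalIdeal R :=
    fun i => ⟨evalAt (S.coord 1) (φ (MvPowerSeries.X i)), hI (hφI i)⟩ with hc
  set x := S.coord.symm c with hx
  have hcx : S.coord x = c := S.coord.apply_symm_apply c
  -- So `(φ g)(1) = g(x)` for all `g`. With `g = λ_{y⁻¹} f`, left invariance yields `(φ f)(y) = (φ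
  -- g)(1) = g(x) = f(y x)`.
  have hev : (evalAt (S.coord 1)).comp φ = evalAt c :=
    algHom_eq_of_apply_X_eq (fun i => by rw [evalAt_X]; rfl) (fun i => by
      rw [evalAt_X]; exact (c i).2)
  refine ⟨x, fun i => by rw [hcx]; exact hφI i, ?_⟩
  ext1 f
  refine S.ext_of_evalAt hR fun y => ?_
  have h1 := S.evalAt_leftTranslation y⁻¹ 1 (φ f)
  rw [← hφ, inv_inv, mul_one] at h1
  have h2 := DFunLike.congr_fun hev (S.leftTranslation y⁻¹ f)
  rw [AlgHom.comp_apply] at h2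
  rw [← h1, h2, ← hcx, evalAt_leftTranslation, evalAt_rightTranslation, inv_inv]

end StandardGroup

/-! ### Values of rational Lie polynomials -/

section LieEvaluation

theorem exists_smul_eq_one_tmul {M : Type*} [AddCommGroup M] (y : ℚ ⊗[ℤ] M) :
    ∃ (n : ℕ) (m : M), n ≠ 0 ∧ n • y = (1 : ℚ) ⊗ₜ[ℤ] m := by
  induction y using TensorProduct.induction_on with
  | zero => exact ⟨1, 0, one_ne_zero, by simp⟩
  | tmul q m =>
    refine ⟨q.den, q.num • m, q.den_ne_zero, ?_⟩
    rw [← TensorProduct.smul_tmul, TensorProduct.smul_tmul']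
    congr 1
    rw [nsmul_eq_mul, zsmul_eq_mul, mul_one, Rat.den_mul_eq_num]
  | add x y hx hy =>
    obtain ⟨a, m, ha, hm⟩ := hx
    obtain ⟨b, n, hb, hn⟩ := hy
    refine ⟨a * b, b • m + a • n, mul_ne_zero ha hb, ?_⟩
    rw [smul_add, mul_comm a b, mul_smul, hm, mul_comm b a, mul_smul, hn, TensorProduct.tmul_add,
      TensorProduct.tmul_smul, TensorProduct.tmul_smul]

attribute [local instance] LieRing.ofAssociativeRing

/-- Both sides are Lie homomorphisms in `h` from the free Lie algebra, and they agree on the two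
generators. -/
theorem map_evalLiePolynomial {M : Type*} [LieRing M] {Q : Type*} [Ring Q] [Algebra ℚ Q]
    (j : ℚ ⊗[ℤ] M →ₗ[ℚ] Q) (hj : ∀ x y, j ⁅x, y⁆ = j x * j y - j y * j x) (a b : M)
    (h : FreeLieAlgebra ℚ (Fin 2)) : j (evalLiePolynomial a b h)
      = FreeAlgebra.lift ℚ ![j ((1 : ℚ) ⊗ₜ[ℤ] a), j ((1 : ℚ) ⊗ₜ[ℤ] b)] (freeLieToAssoc h) := by
  let jL : ℚ ⊗[ℤ] M →ₗ⁅ℚ⁆ Q := { j with map_lie' := fun {x y} => hj x y }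
  let F := FreeAlgebra.lift ℚ ![j ((1 : ℚ) ⊗ₜ[ℤ] a), j ((1 : ℚ) ⊗ₜ[ℤ] b)]
  have key : jL.comp (FreeLieAlgebra.lift ℚ ![(1 : ℚ) ⊗ₜ[ℤ] a, (1 : ℚ) ⊗ₜ[ℤ] b])
      = F.toLieHom.comp freeLieToAssoc := by
    refine FreeLieAlgebra.hom_ext fun i => ?_
    have h1 : freeLieToAssoc (FreeLieAlgebra.of ℚ i) = FreeAlgebra.ι ℚ i :=
      FreeLieAlgebra.lift_of_apply _ _
    simp only [LieHom.comp_apply, FreeLieAlgebra.lift_of_apply, h1]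
    change j _ = F (FreeAlgebra.ι ℚ i)
    rw [FreeAlgebra.lift_ι_apply]
    fin_cases i <;> rfl
  exact DFunLike.congr_fun key h

end LieEvaluation

/-! ### Lie rings embedded in associative rings -/

section LieEmbedding

variable {p : ℕ} {M : Type*} [LieRing M] {D : Type*} [Ring D] {τ : M →+ D}

theorem baseChange_lie (hτ : ∀ x y, τ ⁅x, y⁆ = τ x * τ y - τ y * τ x) (x y : ℚ ⊗[ℤ] M) :
    τ.toIntLinearMap.baseChange ℚ ⁅x, y⁆
      = τ.toIntLinearMap.baseChange ℚ x * τ.toIntLinearMap.baseChange ℚ y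
        - τ.toIntLinearMap.baseChange ℚ y * τ.toIntLinearMap.baseChange ℚ x := by
  induction x using TensorProduct.induction_on with
  | zero => simp
  | add x x' hx hx' =>
    rw [add_lie, map_add, map_add, hx, hx']
    noncomm_ring
  | tmul q x =>
    induction y using TensorProduct.induction_on with
    | zero =>
      rw [show ⁅q ⊗ₜ[ℤ] x, (0 : ℚ ⊗[ℤ] M)⁆ = 0 from lie_zero (L := ℚ ⊗[ℤ] M) (M := ℚ ⊗[ℤ] M) _]
      simp
    | add y y' hy hy' =>
      rw [show ⁅q ⊗ₜ[ℤ] x, y + y'⁆ = ⁅q ⊗ₜ[ℤ] x, y⁆ + ⁅q ⊗ₜ[ℤ] x, y'⁆ from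
          lie_add (L := ℚ ⊗[ℤ] M) (M := ℚ ⊗[ℤ] M) _ _ _,
        map_add, map_add, hy, hy']
      noncomm_ring
    | tmul r y =>
      rw [LieAlgebra.ExtendScalars.bracket_tmul]
      simp [hτ, TensorProduct.tmul_sub, mul_comm]

theorem one_tmul_eq_of_isBCHTerm (hτ : ∀ x y, τ ⁅x, y⁆ = τ x * τ y - τ y * τ x) {n : ℕ} {a b c : M}
    (h : IsBCHTerm n a b c) : (1 : ℚ) ⊗ₜ[ℤ] τ c
      = FreeAlgebra.lift ℚ ![(1 : ℚ) ⊗ₜ[ℤ] τ a, (1 : ℚ) ⊗ₜ[ℤ] τ b] (bchComponent n) := by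
  obtain ⟨l, hl, hc⟩ := h
  have := map_evalLiePolynomial (τ.toIntLinearMap.baseChange ℚ) (baseChange_lie hτ) a b l
  rw [hl, hc] at this
  simpa using this

/-- The associative computation gives `H_n(a, b) = z` in `D`, while the Lie polynomial gives a value
in `ℚ ⊗ M` only. Clearing its denominator `N` shows `N • z ∈ τ(M)`; the saturation hypothesis `hsat`
puts `z` itself in `τ(M)`, and `N` is cancelled in `ℚ ⊗ M`. -/
theorem exists_isBCHTerm (hD : IsPadicComplete p D) (hτ : ∀ x y, τ ⁅x, y⁆ = τ x * τ y - τ y * τ x)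
    (hinj : Function.Injective τ)
    (hsat : ∀ (n : ℕ) (z : D) (m : M), n ≠ 0 → n • z = τ m → ∃ c, τ c = z) {n : ℕ} {a b : M} {z : D}
    (hz : (1 : ℚ) ⊗ₜ[ℤ] z
      = FreeAlgebra.lift ℚ ![(1 : ℚ) ⊗ₜ[ℤ] τ a, (1 : ℚ) ⊗ₜ[ℤ] τ b] (bchComponent n)) :
    ∃ c, τ c = z ∧ IsBCHTerm n a b c := by
  obtain ⟨l, hl⟩ := exists_freeLieToAssoc_eq_bchComponent n
  set j := τ.toIntLinearMap.baseChange ℚ with hj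
  have hj1 : ∀ m : M, j ((1 : ℚ) ⊗ₜ[ℤ] m) = (1 : ℚ) ⊗ₜ[ℤ] τ m := fun m => by simp [hj]
  have hjl : j (evalLiePolynomial a b l) = (1 : ℚ) ⊗ₜ[ℤ] z := by
    rw [hz, ← hl, ← hj1, ← hj1]
    exact map_evalLiePolynomial j (baseChange_lie hτ) a b l
  have hι : ∀ x y : D, (1 : ℚ) ⊗ₜ[ℤ] x = (1 : ℚ) ⊗ₜ[ℤ] y → x = y :=
    fun x y h => injective_includeRight hD h
  obtain ⟨N, m, hN, hm⟩ := exists_smul_eq_one_tmul (evalLiePolynomial a b l)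
  have hNz : N • z = τ m := by
    apply hι
    rw [← hj1, ← hm, map_nsmul, hjl, TensorProduct.tmul_smul]
  obtain ⟨c, rfl⟩ := hsat N z m hN hNz
  refine ⟨c, rfl, l, hl, ?_⟩
  obtain rfl : N • c = m := hinj (by rw [map_nsmul, hNz])
  rw [TensorProduct.tmul_smul, ← Nat.cast_smul_eq_nsmul ℚ, ← Nat.cast_smul_eq_nsmul ℚ] at hm
  exact (smul_right_injective _ (show (N : ℚ) ≠ 0 by exact_mod_cast hN)) hm

end LieEmbedding

/-! ### Exponentials of derivations -/

section DerivationExp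

open PowerSeries

variable {p : ℕ} {R A : Type*} [CommRing R] [CommRing A] [Algebra R A]

theorem HasPadicSum.apply {u : ℕ → Module.End R A} {t : Module.End R A} (h : HasPadicSum p u t)
    (f : A) : HasPadicSum p (fun n => u n f) (t f) :=
  h.map (LinearMap.applyₗ' R f).toAddMonoidHom

theorem IsPadicExp.map_one_of_derivation (hA : IsPadicComplete p A) {a t : Module.End R A}
    (h : IsPadicExp p a t) (ha : ∀ f g, a (f * g) = f * a g + g * a f) : t 1 = 1 := by
  obtain ⟨u, hu, ht⟩ := h
  have h0 : u 0 = 1 := by simpa using hu 0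
  have ha1 : a 1 = 0 := by simpa using ha 1 1
  have h1 := hasPadicSum_of_eventually_zero (p := p) (f := fun n => u n (1 : A)) (N := 1)
    (fun n hn => by
      obtain ⟨m, rfl⟩ := Nat.exists_eq_succ_of_ne_zero (show n ≠ 0 by omega)
      refine hA.torsionFree _ (m + 1).factorial_ne_zero _ ?_
      have := LinearMap.congr_fun (hu (m + 1)) (1 : A)
      rw [pow_succ, Module.End.mul_apply, ha1, map_zero] at this
      exact this)
  refine hA.tendsto_unique (HasPadicSum.apply ht 1) ?_
  rw [Finset.sum_range_one, h0] at h1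
  exact h1

variable [hp : Fact p.Prime]

theorem IsPadicExp.sub_one_mem {D : Type*} [Ring D] (hD : IsPadicComplete p D) {a t : D}
    (ha : a ∈ padicSub p (boldExp p) D) (h : IsPadicExp p a t) :
    t - 1 ∈ padicSub p (boldExp p) D := by
  obtain ⟨u, hu, ht⟩ := h
  have h0 : u 0 = 1 := by simpa using hu 0
  obtain ⟨N, hN⟩ := padicTendsto_iff.mp ht (boldExp p)
  have h1 := hN (N + 1) (by omega)
  rw [Finset.sum_range_succ', h0] at h1
  have h2 : ∑ n ∈ Finset.range N, u (n + 1) ∈ padicSub p (boldExp p) D :=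
    sum_mem fun n _ => expTerm_mem hD ha (hu (n + 1))
      (factorial_valuation_add_boldExp n.succ_ne_zero)
  convert sub_mem h2 h1 using 1
  abel

/-- The exponential of a derivation is multiplicative. -/
theorem IsPadicExp.map_mul_of_derivation (hA : IsPadicComplete p A) {a t : Module.End R A}
    (h : IsPadicExp p a t) (ha : ∀ f g, a (f * g) = f * a g + g * a f) (f g : A) :
    t (f * g) = t f * t g := by
  obtain ⟨u, hu, ht⟩ := h
  have hD : IsPadicComplete p (Module.End R A) := hA.moduleEnd
  have hrec : ∀ n, (n + 1) • u (n + 1) = a * u n := by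
    intro n
    refine hD.smul_cancel n.factorial_ne_zero ?_
    rw [smul_smul, mul_comm, ← Nat.factorial_succ, hu, ← mul_smul_comm, hu, pow_succ']
  have hrec' : ∀ n f, u (n + 1) f * ((n : A) + 1) = a (u n f) := by
    intro n f
    have := LinearMap.congr_fun (hrec n) f
    rw [LinearMap.smul_apply, nsmul_eq_mul] at this
    push_cast at this
    rw [mul_comm, this, Module.End.mul_apply]
  have hd : ∀ f, d⁄dX A (mk fun n => u n f) = mk fun n => a (u n f) := by
    intro f
    ext n
    rw [coeff_derivative, coeff_mk, coeff_mk, hrec']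
  have h0 : u 0 = 1 := by simpa using hu 0
  -- This is the Leibniz rule for the divided powers `a^n / n!`. The series `∑ u n f T^n` solves
  -- `dy/dT = a y`; since `a` is a derivation, the product of the series of `f` and `g` solves it
  -- too, with initial value `f * g`.
  have key : ∀ n, u n (f * g) = coeff n ((mk fun n => u n f) * mk fun n => u n g) := by
    intro n
    induction n with
    | zero => simp [h0]
    | succ n ih =>
      refine hA.smul_cancel n.succ_ne_zero ?_
      have h1 := LinearMap.congr_fun (hrec n) (f * g)
      rw [LinearMap.smul_apply, Module.End.mul_apply, ih] at h1
      have h2 := coeff_derivative ((mk fun n => u n f) * mk fun n => u n g) n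
      rw [Derivation.leibniz, hd, hd, smul_eq_mul, smul_eq_mul, map_add,
        mul_comm (mk fun n => u n g), coeff_mul, coeff_mul] at h2
      rw [Nat.succ_eq_add_one, h1, nsmul_eq_mul, mul_comm ((n + 1 : ℕ) : A), Nat.cast_add,
        Nat.cast_one, ← h2,
        coeff_mul, map_sum, ← Finset.sum_add_distrib]
      refine Finset.sum_congr rfl fun x _ => ?_
      simp only [coeff_mk]
      rw [ha]
      ring
  refine hA.tendsto_unique (HasPadicSum.apply ht (f * g)) ?_
  have := HasPadicSum.mul (f := mk fun n => u n f) (g := mk fun n => u n g) (s := t f) (t := t g)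
    (by simpa only [coeff_mk] using HasPadicSum.apply ht f)
    (by simpa only [coeff_mk] using HasPadicSum.apply ht g)
  simp only [← key] at this
  exact this

theorem IsPadicExp.commute_of_commute (hA : IsPadicComplete p A) {a t l : Module.End R A}
    (h : IsPadicExp p a t) (hl : Commute a l) : Commute t l := by
  obtain ⟨u, hu, ht⟩ := h
  have hul : ∀ n, u n * l = l * u n := by
    intro n
    refine (hA.moduleEnd (R := R)).smul_cancel n.factorial_ne_zero ?_
    rw [← smul_mul_assoc, ← mul_smul_comm, hu]
    exact hl.pow_left n
  refine LinearMap.ext fun f => ?_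
  refine hA.tendsto_unique (HasPadicSum.apply ht (l f)) ?_
  have h1 := (HasPadicSum.apply ht f).map l.toAddMonoidHom
  have h2 : ∀ n, u n (l f) = l.toAddMonoidHom (u n f) := fun n => LinearMap.congr_fun (hul n) f
  simp only [← h2] at h1
  exact h1

theorem mem_of_smul_mem_padicSub {M : Type*} [AddCommGroup M] (hM : IsPadicComplete p M) {k : ℕ}
    {x : M} (h : p ^ k • x ∈ padicSub p (2 * k) M) : x ∈ padicSub p k M := by
  obtain ⟨w, hw⟩ := h
  refine ⟨w, hM.smul_cancel (pow_ne_zero k hp.out.ne_zero) ?_⟩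
  rw [← hw]
  simp only [nsmulAddMonoidHom_apply]
  rw [smul_smul]
  congr 1
  ring

/-- If all powers of `e^a` are multiplicative, then `a` is a derivation. -/
theorem IsPadicExp.leibniz_of_map_mul (hA : IsPadicComplete p A) {a t : Module.End R A}
    (h : IsPadicExp p a t) (ht : ∀ n f g, (t ^ n) (f * g) = (t ^ n) f * (t ^ n) g) (f g : A) :
    a (f * g) = f * a g + g * a f := by
  rw [← sub_eq_zero]
  refine hA.separated _ fun k => mem_of_smul_mem_padicSub hA ?_
  have hr := h.pow_sub_mem (hA.moduleEnd (R := R)) k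
  set s := t ^ p ^ k with hs
  set r := s - 1 - p ^ k • a with hrdef
  have hr' : ∀ f, r f ∈ padicSub p (2 * k) A := (mem_padicSub_end hA).mp hr
  have hsf : ∀ f, s f - f = p ^ k • a f + r f := fun f => by
    rw [hrdef, LinearMap.sub_apply, LinearMap.sub_apply, LinearMap.smul_apply,
      Module.End.one_apply, add_sub_cancel]
  have hsm : ∀ f, s f - f ∈ padicSub p k A := by
    intro f
    rw [hsf]
    exact add_mem (smul_mem_padicSub k _) (padicSub_anti (by omega) (hr' f))
  have hs2 : (s f - f) * (s g - g) ∈ padicSub p (2 * k) A := by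
    rw [two_mul]
    exact mul_mem_padicSub (hsm f) (hsm g)
  -- Here `s` is multiplicative and `s = 1 + p ^ k a + r` with `r` divisible by `p ^ (2k)`.
  -- Expanding `s(fg) = s(f) s(g)` shows that the Leibniz defect of `a`, times `p ^ k`, is divisible
  -- by `p ^ (2k)`.
  have h1 : p ^ k • (a (f * g) - (f * a g + g * a f))
      = (s f - f) * (s g - g) + f * r g + g * r f - r (f * g) := by
    have e1 := hsf (f * g)
    have e2 : s (f * g) = s f * s g := ht _ f g
    have e3 := hsf f
    have e4 := hsf g
    rw [nsmul_eq_mul] at *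
    linear_combination e1.symm + e2 - f * e4.symm - g * e3.symm
  rw [h1]
  exact sub_mem (add_mem (add_mem hs2 (mul_mem_padicSub_left _ (hr' g)))
    (mul_mem_padicSub_left _ (hr' f))) (hr' _)

/-- The same differentiation argument: `t ^ (p ^ k)` commutes with `l` and is `1 + p ^ k a` modulo
`p ^ (2k)`, so the commutator of `a` and `l` is divisible by every `p ^ k`. -/
theorem IsPadicExp.commute_of_pow_commute (hA : IsPadicComplete p A) {a t l : Module.End R A}
    (h : IsPadicExp p a t) (hl : Commute t l) : Commute a l := by
  have hD : IsPadicComplete p (Module.End R A) := hA.moduleEnd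
  refine sub_eq_zero.mp (hD.separated _ fun k => mem_of_smul_mem_padicSub hD ?_)
  have hr := h.pow_sub_mem hD k
  have hs : t ^ p ^ k * l = l * t ^ p ^ k := (hl.pow_left _).eq
  have h1 := sub_mem (mul_mem_padicSub_left l hr) (mul_mem_padicSub_right hr l)
  convert h1 using 1
  simp only [sub_mul, mul_sub, hs, smul_sub, smul_mul_assoc, mul_smul_comm, one_mul, mul_one]
  abel

end DerivationExp

/-! ### The Lie algebra of a standard group -/

namespace StandardGroup

variable {R : Type*} [CommRing R] [IsLocalRing R] [UniformSpace R] [IsUniformAddGroup R]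
  [IsTopologicalRing R] [IsLinearTopology R R] [CompactSpace R] [T2Space R]
  {d : ℕ} {G : Type*} [Group G] (S : StandardGroup R d G)

/-- The embedding of `𝕃` into the endomorphism ring of `A`. -/
def toEndHom : S.lieAlgebra →+ Module.End R (MvPowerSeries (Fin d) R) where
  toFun := S.toEnd
  map_zero' := rfl
  map_add' _ _ := rfl

theorem toEndHom_apply (a : S.lieAlgebra) : S.toEndHom a = S.toEnd a := rfl

theorem toEndHom_lie (a b : S.lieAlgebra) : S.toEndHom ⁅a, b⁆
    = S.toEndHom a * S.toEndHom b - S.toEndHom b * S.toEndHom a :=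
  LinearMap.ext fun f => Derivation.commutator_apply f

theorem toEndHom_injective : Function.Injective S.toEndHom := by
  intro a b h
  ext f : 2
  exact LinearMap.congr_fun h f

theorem toEnd_mul (a : S.lieAlgebra) (f g : MvPowerSeries (Fin d) R) :
    S.toEnd a (f * g) = f * S.toEnd a g + g * S.toEnd a f :=
  Derivation.leibniz (a : Derivation R (MvPowerSeries (Fin d) R) (MvPowerSeries (Fin d) R)) f g

theorem toEnd_commute (a : S.lieAlgebra) (x : G) :
    Commute (S.toEnd a) (S.leftTranslation x).toLinearMap :=
  LinearMap.ext fun f => a.2 x f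

theorem exists_toEndHom_eq {D : Module.End R (MvPowerSeries (Fin d) R)}
    (h1 : ∀ f g, D (f * g) = f * D g + g * D f)
    (h2 : ∀ x : G, Commute D (S.leftTranslation x).toLinearMap) :
    ∃ a : S.lieAlgebra, S.toEndHom a = D :=
  ⟨⟨Derivation.mk' D h1, fun x f => LinearMap.congr_fun (h2 x) f⟩, rfl⟩

variable {p : ℕ} [hp : Fact p.Prime]

/-- `𝕃` is saturated in the endomorphism ring: the Leibniz rule and commutation with left
translations are linear conditions on `D`, so in a torsion-free module they hold for `D` once they
hold for `n • D`. Consequently the `p`-adic filtration of `𝕃` is the induced one. -/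
theorem exists_toEndHom_eq_of_smul_eq (hA : IsPadicComplete p (MvPowerSeries (Fin d) R)) {n : ℕ}
    (hn : n ≠ 0) {D : Module.End R (MvPowerSeries (Fin d) R)} {b : S.lieAlgebra}
    (h : n • D = S.toEndHom b) : ∃ a : S.lieAlgebra, S.toEndHom a = D := by
  have hD : ∀ f, n • D f = S.toEnd b f := fun f => LinearMap.congr_fun h f
  refine S.exists_toEndHom_eq (fun f g => hA.smul_cancel hn ?_) fun x => ?_
  · rw [hD, toEnd_mul, smul_add, ← mul_smul_comm, ← mul_smul_comm, hD, hD]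
  · refine (hA.moduleEnd (R := R)).smul_cancel hn ?_
    rw [← smul_mul_assoc, ← mul_smul_comm, h]
    exact (S.toEnd_commute b x).eq

theorem toEndHom_mem_padicSub_iff (hA : IsPadicComplete p (MvPowerSeries (Fin d) R)) {k : ℕ}
    {a : S.lieAlgebra} : S.toEndHom a ∈ padicSub p k (Module.End R (MvPowerSeries (Fin d) R)) ↔
      a ∈ padicSub p k S.lieAlgebra := by
  refine ⟨fun h => ?_, map_mem_padicSub S.toEndHom⟩
  obtain ⟨D, hD⟩ := h
  obtain ⟨b, rfl⟩ := S.exists_toEndHom_eq_of_smul_eq hA (pow_ne_zero k hp.out.ne_zero) hD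
  exact ⟨b, S.toEndHom_injective (by rw [← hD]; exact map_nsmul S.toEndHom _ b)⟩

theorem mem_multipleLie_iff (hA : IsPadicComplete p (MvPowerSeries (Fin d) R))
    {a : S.lieAlgebra} : a ∈ S.multipleLie (boldP p) ↔
      S.toEnd a ∈ padicSub p (boldExp p) (Module.End R (MvPowerSeries (Fin d) R)) := by
  rw [← toEndHom_apply, toEndHom_mem_padicSub_iff S hA, mem_padicSub, pow_boldExp]
  simp only [multipleLie, LinearMap.mem_range, LinearMap.lsmul_apply, Nat.cast_smul_eq_nsmul]

theorem padicTendsto_toEndHom_iff (hA : IsPadicComplete p (MvPowerSeries (Fin d) R))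
    {u : ℕ → S.lieAlgebra} {c : S.lieAlgebra} :
    PadicTendsto p (fun n => S.toEndHom (u n)) (S.toEndHom c) ↔ PadicTendsto p u c := by
  simp only [padicTendsto_iff, ← map_sub, toEndHom_mem_padicSub_iff S hA]

theorem isBCH_unique (hA : IsPadicComplete p (MvPowerSeries (Fin d) R)) {a b c c' : S.lieAlgebra}
    (h : IsBCH p a b c) (h' : IsBCH p a b c') : c = c' := by
  obtain ⟨z, hz, hc⟩ := h
  obtain ⟨z', hz', hc'⟩ := h'
  have hD : IsPadicComplete p (Module.End R (MvPowerSeries (Fin d) R)) := hA.moduleEnd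
  obtain rfl : z = z' := funext fun n => S.toEndHom_injective (injective_includeRight hD
    ((one_tmul_eq_of_isBCHTerm S.toEndHom_lie (hz n)).trans
      (one_tmul_eq_of_isBCHTerm S.toEndHom_lie (hz' n)).symm))
  exact S.toEndHom_injective (hD.tendsto_unique ((S.padicTendsto_toEndHom_iff hA).mpr hc)
    ((S.padicTendsto_toEndHom_iff hA).mpr hc'))

/-- The formula in the endomorphism ring yields some logarithm of `s * t`; injectivity of the
exponential identifies it with `c`, and terms and limit then descend to `𝕃`. -/
theorem isBCH_of_isPadicExp_mul (hA : IsPadicComplete p (MvPowerSeries (Fin d) R))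
    {a b c : S.lieAlgebra} (ha : a ∈ S.multipleLie (boldP p)) (hb : b ∈ S.multipleLie (boldP p))
    (hc : c ∈ S.multipleLie (boldP p)) {s t : Module.End R (MvPowerSeries (Fin d) R)}
    (hs : IsPadicExp p (S.toEnd a) s) (ht : IsPadicExp p (S.toEnd b) t)
    (hst : IsPadicExp p (S.toEnd c) (s * t)) : IsBCH p a b c := by
  have hD : IsPadicComplete p (Module.End R (MvPowerSeries (Fin d) R)) := hA.moduleEnd
  rw [mem_multipleLie_iff S hA] at ha hb hc
  obtain ⟨z, c', hz, hterm, hlim, hexp⟩ := exists_bch hD ha hb hs ht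
  have hc' : c' ∈ padicSub p (boldExp p) (Module.End R (MvPowerSeries (Fin d) R)) :=
    hlim.mem fun _ => sum_mem fun n _ => hz n
  obtain rfl : c' = S.toEnd c := hexp.injective hD hc' hc hst
  choose h hh hbch using fun n => exists_isBCHTerm hD S.toEndHom_lie S.toEndHom_injective
    (fun n D m hn h => S.exists_toEndHom_eq_of_smul_eq hA hn h) (a := a) (b := b) (hterm n)
  refine ⟨h, hbch, (S.padicTendsto_toEndHom_iff hA).mp ?_⟩
  simp only [map_sum, hh]
  exact hlim

variable [IsDomain R] [CharZero R] [IsNoetherianRing R]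

theorem exists_isPadicExp_rightTranslation (hR : IsProP p R)
    (hA : IsPadicComplete p (MvPowerSeries (Fin d) R)) {x : G}
    (hx : x ∈ S.points (Ideal.span {(boldP p : R)})) :
    ∃ a ∈ S.multipleLie (boldP p),
      IsPadicExp p (S.toEnd a) (S.rightTranslation x).toLinearMap := by
  obtain ⟨D, hD, hexp⟩ := exists_isPadicExp_eq (hA.moduleEnd (R := R))
    (s := (S.rightTranslation x).toLinearMap) ((mem_padicSub_end hA).mpr fun f => by
      rw [← mem_span_boldP_iff]
      exact S.rightTranslation_sub_mem hx f)
  obtain ⟨a, rfl⟩ := S.exists_toEndHom_eq (D := D)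
    (hexp.leibniz_of_map_mul hA fun n f g => by
      rw [← S.rightTranslation_pow hR]
      exact map_mul (S.rightTranslation (x ^ n)) f g)
    fun y => hexp.commute_of_pow_commute hA
      (LinearMap.ext fun f => S.rightTranslation_leftTranslation hR x y f)
  exact ⟨a, (S.mem_multipleLie_iff hA).mpr hD, hexp⟩

theorem exists_rightTranslation_of_isPadicExp (hR : IsProP p R)
    (hA : IsPadicComplete p (MvPowerSeries (Fin d) R)) {a : S.lieAlgebra}
    (ha : a ∈ S.multipleLie (boldP p)) {t : Module.End R (MvPowerSeries (Fin d) R)}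
    (ht : IsPadicExp p (S.toEnd a) t) :
    ∃ x ∈ S.points (Ideal.span {(boldP p : R)}), (S.rightTranslation x).toLinearMap = t := by
  have hI : Ideal.span {(boldP p : R)} ≤ IsLocalRing.maximalIdeal R := by
    rw [Ideal.span_singleton_le_iff_mem, ← pow_boldExp, Nat.cast_pow]
    refine Ideal.pow_mem_of_mem _ (natCast_mem_maximalIdeal hR) _ ?_
    unfold boldExp
    split_ifs <;> norm_num
  let φ : MvPowerSeries (Fin d) R →ₐ[R] MvPowerSeries (Fin d) R :=
    AlgHom.ofLinearMap t (ht.map_one_of_derivation hA (S.toEnd_mul a))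
      (ht.map_mul_of_derivation hA (S.toEnd_mul a))
  have h1 := ht.sub_one_mem (hA.moduleEnd (R := R)) ((S.mem_multipleLie_iff hA).mp ha)
  obtain ⟨x, hx, hφ⟩ := S.exists_rightTranslation_eq hR hI φ
    (fun x f => LinearMap.congr_fun (ht.commute_of_commute hA (S.toEnd_commute a x)).eq f)
    (fun i => by
      have h2 := map_mem_padicSub (evalAt (S.coord 1)).toLinearMap.toAddMonoidHom
        ((mem_padicSub_end hA).mp h1 (MvPowerSeries.X i))
      rw [← mem_span_boldP_iff] at h2
      have h3 : evalAt (S.coord 1) (t (MvPowerSeries.X i) - MvPowerSeries.X i)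
        ∈ Ideal.span {(boldP p : R)} := h2
      rw [map_sub, evalAt_X, coord_one] at h3
      rw [coord_one]
      change evalAt _ (t (MvPowerSeries.X i)) ∈ _
      simpa using h3)
  refine ⟨x, hx, ?_⟩
  rw [hφ]
  rfl

/-- The action of a subgroup of `G` on `A` by right translations. -/
def rightTranslationHom (hR : IsProP p R) (N : Subgroup G) :
    N →* (MvPowerSeries (Fin d) R ≃ₐ[R] MvPowerSeries (Fin d) R) where
  toFun x := AlgEquiv.ofAlgHom (S.rightTranslation (x : G)) (S.rightTranslation (x⁻¹ : G))
    (AlgHom.ext fun f => by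
      rw [AlgHom.comp_apply, ← S.rightTranslation_mul hR, mul_inv_cancel,
        S.rightTranslation_one hR, AlgHom.id_apply])
    (AlgHom.ext fun f => by
      rw [AlgHom.comp_apply, ← S.rightTranslation_mul hR, inv_mul_cancel,
        S.rightTranslation_one hR, AlgHom.id_apply])
  map_one' := AlgEquiv.ext fun f => S.rightTranslation_one hR f
  map_mul' x y := AlgEquiv.ext fun f => S.rightTranslation_mul hR x y f

end StandardGroup

end

/-! ### The main theorem -/

theorem mainTheorem6 {p : ℕ} [Fact p.Prime]
    {R : Type*} [CommRing R] [IsDomain R] [CharZero R] [IsNoetherianRing R] [IsLocalRing R]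
    [UniformSpace R] [IsUniformAddGroup R] [IsTopologicalRing R] [IsLinearTopology R R]
    [CompactSpace R] [T2Space R] (hR : IsProP p R)
    {d : ℕ} {G : Type*} [Group G] (S : StandardGroup R d G) :
    -- the exponential is well defined on `𝐩𝕃`
    (∀ a ∈ S.multipleLie (boldP p), ∃! t, IsPadicExp p (S.toEnd a) t) ∧
    -- `N = G(𝐩R)`, `E` is the group `{ρ_x} = {e^a}` and `Γ` is the group `Γ(𝐩𝕃)`
    ∃ (N : Subgroup G)
      (E : Subgroup (MvPowerSeries (Fin d) R ≃ₐ[R] MvPowerSeries (Fin d) R))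
      (Γ : Group (S.multipleLie (boldP p))),
      (N : Set G) = S.points (Ideal.span {(boldP p : R)}) ∧
      (fun φ => φ.toLinearMap) '' (E : Set (MvPowerSeries (Fin d) R ≃ₐ[R] MvPowerSeries (Fin d) R))
        = (fun x => (S.rightTranslation x).toLinearMap) ''
            S.points (Ideal.span {(boldP p : R)}) ∧
      (fun x => (S.rightTranslation x).toLinearMap) '' S.points (Ideal.span {(boldP p : R)})
        = {t : Module.End R (MvPowerSeries (Fin d) R) |
            ∃ a ∈ S.multipleLie (boldP p), IsPadicExp p (S.toEnd a) t} ∧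
      (∀ a b c : S.multipleLie (boldP p),
        IsBCH p (a : S.lieAlgebra) (b : S.lieAlgebra) (c : S.lieAlgebra) ↔ Γ.mul a b = c) ∧
      ∃ Φ : N ≃* S.multipleLie (boldP p), ∀ x : N,
        IsPadicExp p (S.toEnd (Φ x)) (S.rightTranslation (x : G)).toLinearMap := by
  have hA : IsPadicComplete p (MvPowerSeries (Fin d) R) :=
    (isPadicComplete_of_isProP hR).mvPowerSeries (Fin d)
  have hD : IsPadicComplete p (Module.End R (MvPowerSeries (Fin d) R)) := hA.moduleEnd
  refine ⟨fun a ha => ?_, ?_⟩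
  · obtain ⟨t, ht⟩ := exists_isPadicExp hD ((S.mem_multipleLie_iff hA).mp ha)
    exact ⟨t, ht, fun s hs => hs.unique hD ht⟩
  set N := S.pointsSubgroup (isClosed_span_singleton (boldP p : R)) with hN
  let ρ : N →* (MvPowerSeries (Fin d) R ≃ₐ[R] MvPowerSeries (Fin d) R) := S.rightTranslationHom hR N
  choose log hlog_mem hlog using fun x : N => S.exists_isPadicExp_rightTranslation hR hA x.2
  have hbij : Function.Bijective
      (fun x : N => (⟨log x, hlog_mem x⟩ : S.multipleLie (boldP p))) := by
    constructor
    · intro x y hxy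
      have h1 : log x = log y := congrArg Subtype.val hxy
      have h2 := hlog x
      rw [h1] at h2
      exact Subtype.ext (S.rightTranslation_injective
        (AlgHom.toLinearMap_injective (h2.unique hD (hlog y))))
    · rintro ⟨a, ha⟩
      obtain ⟨t, ht⟩ := exists_isPadicExp hD ((S.mem_multipleLie_iff hA).mp ha)
      obtain ⟨x, hx, rfl⟩ := S.exists_rightTranslation_of_isPadicExp hR hA ha ht
      refine ⟨⟨x, hx⟩, Subtype.ext (S.toEndHom_injective ?_)⟩
      exact (hlog ⟨x, hx⟩).injective hD ((S.mem_multipleLie_iff hA).mp (hlog_mem _))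
        ((S.mem_multipleLie_iff hA).mp ha) ht
  let Φ : N ≃ S.multipleLie (boldP p) := Equiv.ofBijective _ hbij
  have hΦ : ∀ x : N, IsPadicExp p (S.toEnd (Φ x)) (S.rightTranslation (x : G)).toLinearMap := hlog
  -- The group structure is transported along `Φ`, so no group axiom has to be checked for the
  -- series `H`; that the product is `H` follows from `e^a e^b = ρ_x ρ_y = ρ_{xy}`.
  let Γ : Group (S.multipleLie (boldP p)) := Φ.symm.group
  refine ⟨N, ρ.range, Γ, rfl, ?_, ?_, fun a b c => ?_, ⟨Φ, fun x y => ?_⟩, hΦ⟩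
  · ext t
    constructor
    · rintro ⟨_, ⟨x, rfl⟩, rfl⟩
      exact ⟨x, x.2, rfl⟩
    · rintro ⟨x, hx, rfl⟩
      exact ⟨_, ⟨⟨x, hx⟩, rfl⟩, rfl⟩
  · ext t
    constructor
    · rintro ⟨x, hx, rfl⟩
      exact S.exists_isPadicExp_rightTranslation hR hA hx
    · rintro ⟨a, ha, ht⟩
      exact S.exists_rightTranslation_of_isPadicExp hR hA ha ht
  · obtain ⟨x, rfl⟩ := Φ.surjective a
    obtain ⟨y, rfl⟩ := Φ.surjective b
    have hmul : Γ.mul (Φ x) (Φ y) = Φ (x * y) := by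
      change Φ (Φ.symm (Φ x) * Φ.symm (Φ y)) = _
      rw [Φ.symm_apply_apply, Φ.symm_apply_apply]
    have hxy := hΦ (x * y)
    rw [show (S.rightTranslation ((x * y : N) : G)).toLinearMap
        = (S.rightTranslation (x : G)).toLinearMap * (S.rightTranslation (y : G)).toLinearMap from
      LinearMap.ext fun f => S.rightTranslation_mul hR x y f] at hxy
    have hbch := S.isBCH_of_isPadicExp_mul hA (Φ x).2 (Φ y).2 (Φ (x * y)).2 (hΦ x) (hΦ y) hxy
    rw [hmul]
    constructor
    · intro h
      exact Subtype.ext (S.isBCH_unique hA hbch h)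
    · rintro rfl
      exact hbch
  · change Φ (x * y) = Φ (Φ.symm (Φ x) * Φ.symm (Φ y))
    rw [Φ.symm_apply_apply, Φ.symm_apply_apply]
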